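/- Let $\Gamma$ be a compact connected metric graph of genus $g$, i.e. a compact connected metric space that is a finite topological graph whose edges have positive finite lengths and whose metric is the path metric, and $g=\dim H_1(\Gamma,\mathbb R)$. Let $\mathrm{Div}^d(\Gamma)$ be the set of divisors (elements of the free abelian group on the points of $\Gamma$) of degree $d$, and $\mathrm{Div}^d_+(\Gamma)$ the set of effective divisors of degree $d$, with the quotient topology from $\Gamma^d\to\mathrm{Div}^d_+(\Gamma)$, $(x_1,\dots,x_d)\mapsto (x_1)+\cdots+(x_d)$. Let $\mathrm{Prin}(\Gamma)$ be the group of divisors $\mathrm{div}(\varphi)=\sum_p\sigma_p(\varphi)(p)$, where $\varphi$ runs over the continuous piecewise affine functions on $\Gamma$ with integer slopes and $\sigma_p(\varphi)$ is the sum of the incoming slopes of $\varphi$ at $p$, and let $\mathrm{Pic}^d(\Gamma)=\mathrm{Div}^d(\Gamma)/\mathrm{Prin}(\Gamma)$. Fix a base point $q\in\Gamma$, and let $\Phi_q\colon\Gamma\to\mathrm{Jac}(\Gamma)=H_1(\Gamma,\mathbb R)/H_1(\Gamma,\mathbb Z)$ be the map sending $p$ to the class of the orthogonal projection to $H_1(\Gamma,\mathbb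 R)$ (for the edge-length inner product on real $1$-chains) of the chain of a path from $q$ to $p$. Its additive extension to divisors induces a bijection $\mathrm{Pic}^d(\Gamma)\to\mathrm{Jac}(\Gamma)$ (the tropical Abel–Jacobi theorem), through which $\mathrm{Pic}^d(\Gamma)$ inherits the topology and the notion of polyhedral subset of the real torus $\mathrm{Jac}(\Gamma)$. A subset of $\mathrm{Jac}(\Gamma)$ is called polyhedral of pure dimension $d$ if it is the image of a finite union of $d$-dimensional (convex, compact) polytopes in $H_1(\Gamma,\mathbb R)$. Let $0\le d\le g$, let $S^{(d)}\colon\mathrm{Div}^d_+(\Gamma)\to\mathrm{Pic}^d(\Gamma)$, $D\mapsto[D]$, be the Abel–Jacobi map, and let $W_d$ be its image. Then: (a) $S^{(d)}$ is "birational" onto its image: there is a subset $U_d\subseteq W_d$, open and dense in $W_d$, such that the induced map $(S^{(d)})^{-1}(U_d)\to U_d$ is a homeomorphism. (b) $W_d$ is a polyhedral subset of $\mathrm{Pic}^d(\Gamma)$ of pure dimension $d$. -/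

import Mathlib

open Set Topology

noncomputable section

/-- `f` is piecewise linear with integral slopes on the interval `[0, L]`: there are finitely many
break points such that `f` is affine with an integral slope on every closed subinterval of `[0, L]`
whose interior contains no break point. (Values of `f` outside `[0, L]` are irrelevant.) -/
def IsIntegralPL (L : ℝ) (f : ℝ → ℝ) : Prop :=
  ∃ s : Finset ℝ, ∀ a b : ℝ, 0 ≤ a → b ≤ L → Disjoint (Ioo a b) (s : Set ℝ) →
    ∃ (m : ℤ) (c : ℝ), ∀ t ∈ Icc a b, f t = m * t + c

namespace IsIntegralPL

theorem zero (L : ℝ) : IsIntegralPL L (fun _ => 0) :=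
  ⟨∅, fun _ _ _ _ _ => ⟨0, 0, fun t _ => by simp⟩⟩

theorem add {L : ℝ} {f g : ℝ → ℝ} (hf : IsIntegralPL L f) (hg : IsIntegralPL L g) :
    IsIntegralPL L (fun t => f t + g t) := by
  classical
  obtain ⟨s, hs⟩ := hf
  obtain ⟨s', hs'⟩ := hg
  refine ⟨s ∪ s', fun a b ha hb h => ?_⟩
  rw [Finset.coe_union, Set.disjoint_union_right] at h
  obtain ⟨m, c, hm⟩ := hs a b ha hb h.1
  obtain ⟨m', c', hm'⟩ := hs' a b ha hb h.2
  refine ⟨m + m', c + c', fun t ht => ?_⟩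
  simp only [hm t ht, hm' t ht]
  push_cast
  ring

theorem neg {L : ℝ} {f : ℝ → ℝ} (hf : IsIntegralPL L f) : IsIntegralPL L (fun t => -f t) := by
  obtain ⟨s, hs⟩ := hf
  refine ⟨s, fun a b ha hb h => ?_⟩
  obtain ⟨m, c, hm⟩ := hs a b ha hb h
  refine ⟨-m, -c, fun t ht => ?_⟩
  simp only [hm t ht]
  push_cast
  ring

theorem differentiableWithinAt_Iio {L : ℝ} {f : ℝ → ℝ} (hf : IsIntegralPL L f) {t : ℝ}
    (h0 : 0 < t) (hL : t ≤ L) : DifferentiableWithinAt ℝ f (Iio t) t := by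
  obtain ⟨s, hs⟩ := hf
  have h1 : ∀ᶠ x in 𝓝[<] t, x ∉ (s : Set ℝ) := by
    have h2 : ((s : Set ℝ) \ {t})ᶜ ∈ 𝓝 t :=
      ((s.finite_toSet.subset Set.sdiff_subset).isClosed.isOpen_compl).mem_nhds (by simp)
    filter_upwards [nhdsWithin_le_nhds h2, self_mem_nhdsWithin] with x hx hx' hxs
    exact hx ⟨hxs, ne_of_lt hx'⟩
  obtain ⟨l, hl, hl'⟩ := (mem_nhdsLT_iff_exists_Ioo_subset' h0).1 h1
  have hlt : max l 0 < t := max_lt hl h0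
  obtain ⟨m, c, hm⟩ := hs (max l 0) t (le_max_right _ _) hL (by
    rw [Set.disjoint_left]
    intro x hx
    exact hl' ⟨lt_of_le_of_lt (le_max_left _ _) hx.1, hx.2⟩)
  have h3 : DifferentiableWithinAt ℝ (fun x : ℝ => (m : ℝ) * x + c) (Iio t) t := by fun_prop
  refine h3.congr_of_eventuallyEq ?_ (hm t ⟨hlt.le, le_rfl⟩)
  filter_upwards [Ioo_mem_nhdsLT hlt] with x hx
  exact hm x ⟨hx.1.le, hx.2.le⟩

theorem differentiableWithinAt_Ioi {L : ℝ} {f : ℝ → ℝ} (hf : IsIntegralPL L f) {t : ℝ}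
    (h0 : 0 ≤ t) (hL : t < L) : DifferentiableWithinAt ℝ f (Ioi t) t := by
  obtain ⟨s, hs⟩ := hf
  have h1 : ∀ᶠ x in 𝓝[>] t, x ∉ (s : Set ℝ) := by
    have h2 : ((s : Set ℝ) \ {t})ᶜ ∈ 𝓝 t :=
      ((s.finite_toSet.subset Set.sdiff_subset).isClosed.isOpen_compl).mem_nhds (by simp)
    filter_upwards [nhdsWithin_le_nhds h2, self_mem_nhdsWithin] with x hx hx' hxs
    exact hx ⟨hxs, ne_of_gt hx'⟩
  obtain ⟨u, hu, hu'⟩ := (mem_nhdsGT_iff_exists_Ioo_subset' hL).1 h1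
  have hlt : t < min u L := lt_min hu hL
  obtain ⟨m, c, hm⟩ := hs t (min u L) h0 (min_le_right _ _) (by
    rw [Set.disjoint_left]
    intro x hx
    exact hu' ⟨hx.1, lt_of_lt_of_le hx.2 (min_le_left _ _)⟩)
  have h3 : DifferentiableWithinAt ℝ (fun x : ℝ => (m : ℝ) * x + c) (Ioi t) t := by fun_prop
  refine h3.congr_of_eventuallyEq ?_ (hm t ⟨le_rfl, hlt.le⟩)
  filter_upwards [Ioo_mem_nhdsGT hlt] with x hx
  exact hm x ⟨hx.1.le, hx.2.le⟩

end IsIntegralPL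

/-- A metric graph structure on a metric space `Γ`: a presentation of `Γ` as a finite topological
graph, with edges parametrized by arc length, whose metric is the path metric. In other words, `Γ`
together with a model, i.e. a finite weighted graph (loops and multiple edges allowed) whose
geometric realization is `Γ`. -/
structure MetricGraph (Γ : Type*) [MetricSpace Γ] where
  /-- the vertex set -/
  V : Finset Γ
  /-- the set of edges -/
  E : Type
  [fintypeE : Fintype E]
  [decidableEqE : DecidableEq E]
  /-- the length of an edge -/
  len : E → ℝ
  len_pos : ∀ e, 0 < len e
  /-- the parametrization of a closed (oriented) edge `e` by the interval `[0, len e]`;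
  its values outside this interval are irrelevant -/
  param : E → ℝ → Γ
  continuousOn_param : ∀ e, ContinuousOn (param e) (Icc 0 (len e))
  /-- the closed edges start and end at vertices -/
  param_zero_mem : ∀ e, param e 0 ∈ V
  param_len_mem : ∀ e, param e (len e) ∈ V
  /-- the open edges are disjoint from the vertices -/
  param_notMem : ∀ e, ∀ t ∈ Ioo 0 (len e), param e t ∉ V
  /-- the open edges are embedded and pairwise disjoint -/
  param_inj : ∀ e e', ∀ t ∈ Ioo 0 (len e), ∀ t' ∈ Ioo 0 (len e'),
    param e t = param e' t' → e = e' ∧ t = t'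
  /-- vertices and edges cover `Γ` -/
  cover : ∀ p : Γ, p ∈ V ∨ ∃ e, ∃ t ∈ Icc 0 (len e), param e t = p
  /-- the edges are parametrized by arc length -/
  length_param : ∀ e a b, 0 ≤ a → a ≤ b → b ≤ len e →
    eVariationOn (param e) (Icc a b) = ENNReal.ofReal (b - a)
  /-- the metric is the path metric: distances are infima of lengths of paths -/
  edist_eq_iInf_length : ∀ x y : Γ, edist x y = ⨅ γ : Path x y, eVariationOn γ univ

/-- A divisor on `Γ`: an element of the free abelian group on the points of `Γ`. -/
abbrev Divisor (Γ : Type*) : Type _ := Γ →₀ ℤ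

/-- `Div^d(Γ)`, the divisors of degree `d`. -/
def DivisorDeg (Γ : Type*) (d : ℤ) : Type _ := {D : Divisor Γ // D.degree = d}

/-- `Div^d_+(Γ)`, the effective divisors of degree `d`. -/
def EffDivisor (Γ : Type*) (d : ℕ) : Type _ := {D : Divisor Γ // 0 ≤ D ∧ D.degree = d}

/-- The map `Γ^d → Div^d_+(Γ)` sending `(x₁, …, x_d)` to `(x₁) + ⋯ + (x_d)`. -/
def EffDivisor.ofTuple (Γ : Type*) (d : ℕ) (x : Fin d → Γ) : EffDivisor Γ d :=
  ⟨∑ i, Finsupp.single (x i) 1,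
    Finset.sum_nonneg fun i _ => Finsupp.single_nonneg.2 zero_le_one, by
      simp [map_sum, Finsupp.degree_single]⟩

/-- `Div^d_+(Γ)` carries the quotient topology coming from its identification with the
quotient of `Γ^d` by the symmetric group. -/
instance (Γ : Type*) [TopologicalSpace Γ] (d : ℕ) : TopologicalSpace (EffDivisor Γ d) :=
  TopologicalSpace.coinduced (EffDivisor.ofTuple Γ d) inferInstance

/-- The inclusion `Div^d_+(Γ) ⊆ Div^d(Γ)`. -/
def EffDivisor.toDivisorDeg {Γ : Type*} {d : ℕ} (D : EffDivisor Γ d) : DivisorDeg Γ d :=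
  ⟨D.1, D.2.2⟩

namespace MetricGraph

variable {Γ : Type*} [MetricSpace Γ] (G : MetricGraph Γ)

attribute [instance] MetricGraph.fintypeE MetricGraph.decidableEqE

/-! ### Rational functions, principal divisors and the Picard groups -/

/-- Membership in `R(Γ)`: continuous piecewise affine functions with integer slopes. -/
structure IsRational (φ : Γ → ℝ) : Prop where
  continuous : Continuous φ
  isIntegralPL : ∀ e, IsIntegralPL (G.len e) (fun t => φ (G.param e t))

/-- `σ_p(φ)`, the sum of the incoming slopes of `φ` at `p`. On an edge `e`, a parameter `t > 0`
with `G.param e t = p` is the end of an incoming direction along which `e` is traversed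
positively, and a parameter `t < G.len e` with `G.param e t = p` is the end of an incoming
direction along which `e` is traversed negatively. -/
def incomingSlopes (φ : Γ → ℝ) (p : Γ) : ℝ :=
  ∑ e, ((∑ᶠ t ∈ {t | t ∈ Ioc 0 (G.len e) ∧ G.param e t = p},
      derivWithin (fun t => φ (G.param e t)) (Iio t) t) +
    ∑ᶠ t ∈ {t | t ∈ Ico 0 (G.len e) ∧ G.param e t = p},
      -derivWithin (fun t => φ (G.param e t)) (Ioi t) t)

theorem finite_fiber (e : G.E) (p : Γ) : {t | t ∈ Icc 0 (G.len e) ∧ G.param e t = p}.Finite := by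
  have h : {t | t ∈ Ioo 0 (G.len e) ∧ G.param e t = p}.Subsingleton := fun t ht t' ht' =>
    (G.param_inj e e t ht.1 t' ht'.1 (ht.2.trans ht'.2.symm)).2
  refine (h.finite.union (Set.toFinite {0, G.len e})).subset ?_
  rintro t ⟨⟨h0, h1⟩, h2⟩
  rcases h0.eq_or_lt with rfl | h0
  · simp
  rcases h1.eq_or_lt with rfl | h1
  · simp
  exact Or.inl ⟨⟨h0, h1⟩, h2⟩

theorem incomingSlopes_zero (p : Γ) : G.incomingSlopes (fun _ => 0) p = 0 := by
  simp [incomingSlopes]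

theorem incomingSlopes_add {φ ψ : Γ → ℝ} (hφ : G.IsRational φ) (hψ : G.IsRational ψ) (p : Γ) :
    G.incomingSlopes (fun x => φ x + ψ x) p = G.incomingSlopes φ p + G.incomingSlopes ψ p := by
  unfold incomingSlopes
  rw [← Finset.sum_add_distrib]
  refine Finset.sum_congr rfl fun e _ => ?_
  rw [add_add_add_comm, ← finsum_mem_add_distrib, ← finsum_mem_add_distrib]
  · congr 1
    · refine finsum_mem_congr rfl fun t ht => ?_
      exact derivWithin_fun_add ((hφ.isIntegralPL e).differentiableWithinAt_Iio ht.1.1 ht.1.2)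
        ((hψ.isIntegralPL e).differentiableWithinAt_Iio ht.1.1 ht.1.2)
    · refine finsum_mem_congr rfl fun t ht => ?_
      rw [derivWithin_fun_add ((hφ.isIntegralPL e).differentiableWithinAt_Ioi ht.1.1 ht.1.2)
        ((hψ.isIntegralPL e).differentiableWithinAt_Ioi ht.1.1 ht.1.2), neg_add]
  · exact (G.finite_fiber e p).subset fun t ht => ⟨Ico_subset_Icc_self ht.1, ht.2⟩
  · exact (G.finite_fiber e p).subset fun t ht => ⟨Ioc_subset_Icc_self ht.1, ht.2⟩

theorem incomingSlopes_neg {φ : Γ → ℝ} (hφ : G.IsRational φ) (hψ : G.IsRational fun x => -φ x)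
    (p : Γ) : G.incomingSlopes (fun x => -φ x) p = -G.incomingSlopes φ p := by
  have h := G.incomingSlopes_add hφ hψ p
  simp only [add_neg_cancel, incomingSlopes_zero] at h
  linarith

/-- `Prin(Γ)`, the group of principal divisors `div(φ) = ∑ σ_p(φ) (p)` with `φ ∈ R(Γ)`. -/
def principal : AddSubgroup (Divisor Γ) where
  carrier := {D | ∃ φ : Γ → ℝ, G.IsRational φ ∧ ∀ p, (D p : ℝ) = G.incomingSlopes φ p}
  zero_mem' := ⟨fun _ => 0, ⟨continuous_const, fun _ => IsIntegralPL.zero _⟩, fun p => by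
    simp [incomingSlopes_zero]⟩
  add_mem' := by
    rintro D D' ⟨φ, hφ, h⟩ ⟨ψ, hψ, h'⟩
    refine ⟨fun x => φ x + ψ x, ⟨hφ.continuous.add hψ.continuous,
      fun e => (hφ.isIntegralPL e).add (hψ.isIntegralPL e)⟩, fun p => ?_⟩
    rw [G.incomingSlopes_add hφ hψ, ← h, ← h']
    simp
  neg_mem' := by
    rintro D ⟨φ, hφ, h⟩
    have hψ : G.IsRational fun x => -φ x := ⟨hφ.continuous.neg, fun e => (hφ.isIntegralPL e).neg⟩
    refine ⟨_, hψ, fun p => ?_⟩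
    rw [G.incomingSlopes_neg hφ hψ, ← h]
    simp

/-- Linear equivalence on `Div^d(Γ)`: two divisors are equivalent if they differ by a principal
divisor. -/
def linearEquiv (d : ℤ) : Setoid (DivisorDeg Γ d) :=
  (QuotientAddGroup.leftRel G.principal).comap Subtype.val

/-- `Pic^d(Γ) = Div^d(Γ) / Prin(Γ)`. -/
def Pic (d : ℤ) : Type _ := Quotient (G.linearEquiv d)

/-- The Abel–Jacobi map `S^(d) : Div^d_+(Γ) → Pic^d(Γ)`, `D ↦ [D]`. -/
def abelJacobi (d : ℕ) (D : EffDivisor Γ d) : G.Pic d :=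
  Quotient.mk (G.linearEquiv d) D.toDivisorDeg

/-- The effective locus `W_d ⊆ Pic^d(Γ)`, the image of the Abel–Jacobi map. -/
def effectiveLocus (d : ℕ) : Set (G.Pic d) := Set.range (G.abelJacobi d)

/-! ### The tropical Jacobian -/

/-- The boundary map from `1`-chains to `0`-chains with real coefficients. -/
def boundary : (G.E → ℝ) →ₗ[ℝ] (Γ →₀ ℝ) :=
  Fintype.linearCombination ℝ fun e =>
    Finsupp.single (G.param e (G.len e)) (1 : ℝ) - Finsupp.single (G.param e 0) (1 : ℝ)

/-- `H₁(Γ, ℝ)`, the space of real `1`-cycles. -/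
def H1 : Submodule ℝ (G.E → ℝ) := LinearMap.ker G.boundary

/-- `H₁(Γ, ℤ)`, the lattice in `H₁(Γ, ℝ)` of cycles with integral coefficients. -/
def H1Int : AddSubgroup G.H1 where
  carrier := {h | ∀ e, ∃ n : ℤ, (h : G.E → ℝ) e = n}
  zero_mem' e := ⟨0, by simp⟩
  add_mem' := by
    intro a b ha hb e
    obtain ⟨m, hm⟩ := ha e
    obtain ⟨n, hn⟩ := hb e
    exact ⟨m + n, by simp [hm, hn]⟩
  neg_mem' := by
    intro a ha e
    obtain ⟨m, hm⟩ := ha e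
    exact ⟨-m, by simp [hm]⟩

/-- The genus of `Γ`, its first Betti number. -/
def genus : ℕ := Module.finrank ℝ G.H1

/-- The tropical Jacobian `Jac(Γ) = H₁(Γ, ℝ) / H₁(Γ, ℤ)`, a real torus with its quotient
topology. -/
abbrev Jac : Type := G.H1 ⧸ G.H1Int

/-- A subset of the torus `Jac(Γ) = H₁(Γ, ℝ) / H₁(Γ, ℤ)` is polyhedral of pure dimension `k` if it
is the image of a finite union of `k`-dimensional polytopes in `H₁(Γ, ℝ)`. -/
def IsPurePolyhedral (k : ℕ) (P : Set G.Jac) : Prop :=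
  ∃ T : Finset (Finset G.H1),
    (∀ s ∈ T, s.Nonempty ∧ Module.finrank ℝ (vectorSpan ℝ (s : Set G.H1)) = k) ∧
    P = ⋃ s ∈ T, (QuotientAddGroup.mk : G.H1 → G.Jac) '' convexHull ℝ (s : Set G.H1)

/-- The length inner product `⟨a, b⟩ = ∑ₑ len(e) aₑ bₑ` on `1`-chains. -/
def lengthForm : LinearMap.BilinForm ℝ (G.E → ℝ) :=
  ∑ e, G.len e • LinearMap.BilinForm.linMulLin (LinearMap.proj e) (LinearMap.proj e)

theorem lengthForm_apply (a b : G.E → ℝ) : G.lengthForm a b = ∑ e, G.len e * (a e * b e) := by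
  simp [lengthForm, LinearMap.sum_apply]

theorem nondegenerate_restrict : (G.lengthForm.restrict G.H1).Nondegenerate := by
  have key : ∀ a : G.H1, G.lengthForm a a = 0 → a = 0 := by
    intro a ha
    rw [lengthForm_apply, Finset.sum_eq_zero_iff_of_nonneg
      (fun e _ => mul_nonneg (G.len_pos e).le (mul_self_nonneg _))] at ha
    ext e
    have h := ha e (Finset.mem_univ e)
    rcases mul_eq_zero.1 h with h | h
    · exact absurd h (G.len_pos e).ne'
    · simpa using h
  exact ⟨fun a ha => key a (ha a), fun a ha => key a (ha a)⟩

/-- The orthogonal projection from `1`-chains onto `H₁(Γ, ℝ)` with respect to the length inner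
product. -/
def proj : (G.E → ℝ) →ₗ[ℝ] G.H1 :=
  ((G.lengthForm.restrict G.H1).toDual G.nondegenerate_restrict).symm.toLinearMap ∘ₗ
    (LinearMap.lcomp ℝ ℝ G.H1.subtype) ∘ₗ G.lengthForm

theorem lengthForm_proj (c : G.E → ℝ) (z : G.H1) :
    G.lengthForm (G.proj c) z = G.lengthForm c z :=
  LinearMap.BilinForm.apply_toDual_symm_apply (hB := G.nondegenerate_restrict)
    (LinearMap.lcomp ℝ ℝ G.H1.subtype (G.lengthForm c)) z

/-- `G.IsPathChain q p c` means that `c` is the real `1`-chain of a path from `q` to `p` which is a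
finite concatenation of edge segments: moving along the edge `e` from the parameter `s` to the
parameter `t` contributes the signed fraction `(t - s) / len(e)` of `e`. -/
inductive IsPathChain (q : Γ) : Γ → (G.E → ℝ) → Prop
  | refl : IsPathChain q q 0
  | move {c : G.E → ℝ} (e : G.E) (s t : ℝ) (hs : s ∈ Icc 0 (G.len e)) (ht : t ∈ Icc 0 (G.len e))
      (h : IsPathChain q (G.param e s) c) :
      IsPathChain q (G.param e t) (c + Pi.single e ((t - s) / G.len e))

theorem exists_isPathChain [ConnectedSpace Γ] (q p : Γ) : ∃ c, G.IsPathChain q p c := by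
  classical
  set R : Set Γ := {p | ∃ c, G.IsPathChain q p c} with hR
  have hclosed : ∀ A : Set Γ, (∀ e, ∀ s ∈ Icc 0 (G.len e), ∀ t ∈ Icc 0 (G.len e),
      G.param e s ∈ A → G.param e t ∈ A) → IsClosed A := by
    intro A hA
    have hAeq : A = (A ∩ G.V) ∪ ⋃ e ∈ {e | ∃ s ∈ Icc 0 (G.len e), G.param e s ∈ A},
        G.param e '' Icc 0 (G.len e) := by
      ext x
      constructor
      · intro hx
        rcases G.cover x with h | ⟨e, t, ht, rfl⟩
        · exact Or.inl ⟨hx, h⟩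
        · exact Or.inr (Set.mem_biUnion (show e ∈ {e | ∃ s ∈ Icc 0 (G.len e), G.param e s ∈ A}
            from ⟨t, ht, hx⟩) ⟨t, ht, rfl⟩)
      · rintro (h | h)
        · exact h.1
        · simp only [Set.mem_iUnion] at h
          obtain ⟨e, ⟨s, hs, hsA⟩, t, ht, rfl⟩ := h
          exact hA e s hs t ht hsA
    rw [hAeq]
    refine ((G.V.finite_toSet.subset Set.inter_subset_right).isClosed).union ?_
    exact (Set.toFinite _).isClosed_biUnion fun e _ =>
      (isCompact_Icc.image_of_continuousOn (G.continuousOn_param e)).isClosed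
  have h1 : IsClosed R := hclosed R fun e s hs t ht ⟨c, hc⟩ => ⟨_, hc.move e s t hs ht⟩
  have h2 : IsClosed Rᶜ := hclosed Rᶜ fun e s hs t ht h ⟨c, hc⟩ => h ⟨_, hc.move e t s ht hs⟩
  have h3 : R = univ :=
    IsClopen.eq_univ ⟨h1, isClosed_compl_iff.1 h2⟩ ⟨q, 0, IsPathChain.refl⟩
  have h4 : p ∈ R := by
    rw [h3]
    exact Set.mem_univ p
  exact h4

variable [ConnectedSpace Γ]

/-- The Abel–Jacobi map `Φ_q : Γ → Jac(Γ)` with base point `q`: the class of the projection to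
`H₁(Γ, ℝ)` of the chain of a path from `q` to `p`. The class does not depend on the path, as the
chains of two such paths differ by an element of `H₁(Γ, ℤ)`. -/
def pointToJac (q p : Γ) : G.Jac :=
  QuotientAddGroup.mk (G.proj (G.exists_isPathChain q p).choose)

/-- The additive extension of `Φ_q` to divisors. -/
def divisorToJac (q : Γ) (D : Divisor Γ) : G.Jac := D.sum fun p n => n • G.pointToJac q p

/-- The map `Pic^d(Γ) → Jac(Γ)` induced by `Φ_q^(d) : Div^d(Γ) → Jac(Γ)`. It is evaluated on a
chosen representative of the class; by the tropical Abel–Jacobi theorem, the value does not depend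
on the representative, and the map is a bijection. -/
def picToJac (q : Γ) (d : ℤ) (x : G.Pic d) : G.Jac :=
  G.divisorToJac q (Quotient.out x).1

/-- The topology of `Pic^d(Γ)`, inherited from `Jac(Γ)` through the map induced by `Φ_q^(d)`.
(Another base point changes this map by a translation of `Jac(Γ)` only.) -/
abbrev picTopology (q : Γ) (d : ℤ) : TopologicalSpace (G.Pic d) :=
  TopologicalSpace.induced (G.picToJac q d) inferInstance

end MetricGraph

end

/-!
The Abel–Jacobi map is studied on the cells of `Γ^d`, the products of `d` closed edges. On the
cell of `e₁, …, e_d` it lifts to an affine map to `H₁(Γ, ℝ)`, whose linear part is spanned by the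
projections `edgeClass eᵢ` of the edges. For distinct edges, these are linearly independent if and
only if removing the edges does not disconnect `Γ` (`eq_of_linearIndependent`,
`linearIndependent_of_forall`). Both assertions follow from two facts on the divisors in the
interiors of such independent cells.

*Rigidity* (`rigid`): if `D` is in the interior of an independent cell, no other effective divisor
has the same image in the Jacobian. Two divisors `D`, `D'` with the same image differ by the
divisor of a rational function (`exists_potential`). Its slopes are integers and it is convex
along each edge, except at the chip of `D` on this edge, so that it does not decrease away from a
vertex where it is maximal unless through an edge with a chip of `D`. The other edges connect `Γ`,
so all vertices are maxima, and comparing slopes on each edge gives `D = D'`.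

*Density* (`exists_independent_mem`): the images of the interiors of the independent cells are
dense in the image of `Γ^d`. Consider an open set meeting the image, a cell meeting it whose
direction `L` has the largest possible dimension, and a general point of this cell. By a measure
argument (`exists_generic`), all edges touched by a divisor in the fibre over this point have
their class in `L`. Suppose that `dim L < d`. As `d ≤ g`, some edge has its class outside `L`, so
an end `q₀` of it is touched by no divisor in the fibre. In the fibre, which is compact, minimize
the sum of the values of a function `u` which is strictly concave along the edges and satisfies
Kirchhoff's law at the vertices other than `q₀`. A set of chips that can be fired towards `q₀`
without leaving the effective divisors would decrease the sum, hence the minimizer satisfies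
Dhar's burning criterion (`IsMinimizer.exists_lt_card_freeCut`). Burning from `q₀`, and cutting at
each vertex as many burning edges as there are chips, one finds `d` edges touched by the minimizer
whose removal does not disconnect `Γ` (`IsMinimizer.exists_independent`), so `dim L ≥ d` after
all.

By density and compactness, the image is the union of the images of the independent closed cells,
which are `d`-dimensional parallelotopes. The independent open cells form an open subset of the
compact space `Div^d_+(Γ)`; by rigidity, its image is the complement in `W_d` of the image of a
closed set, and the Abel–Jacobi map, being closed, is a homeomorphism over it. The topology of
`Pic^d(Γ)` is related to these maps through the easy half of the Abel–Jacobi theorem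
(`divisorToJac_principal`); the injectivity of the map from `Pic^d(Γ)` to the Jacobian is not
needed.
-/

namespace MetricGraph

variable {Γ : Type*} [MetricSpace Γ] (G : MetricGraph Γ)

/-! ### Points, vertices and edges -/

/-- The initial vertex of an edge. -/
def src (e : G.E) : Γ := G.param e 0

/-- The terminal vertex of an edge. -/
def tgt (e : G.E) : Γ := G.param e (G.len e)

theorem src_mem (e : G.E) : G.src e ∈ G.V := G.param_zero_mem e

theorem tgt_mem (e : G.E) : G.tgt e ∈ G.V := G.param_len_mem e

theorem zero_mem_Icc (e : G.E) : (0 : ℝ) ∈ Icc 0 (G.len e) := ⟨le_rfl, (G.len_pos e).le⟩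

theorem len_mem_Icc (e : G.E) : G.len e ∈ Icc 0 (G.len e) := ⟨(G.len_pos e).le, le_rfl⟩

theorem mem_V_or_openEdge (p : Γ) : p ∈ G.V ∨ ∃ e, ∃ t ∈ Ioo 0 (G.len e), G.param e t = p := by
  rcases G.cover p with h | ⟨e, t, ht, rfl⟩
  · exact Or.inl h
  · by_cases hV : G.param e t ∈ G.V
    · exact Or.inl hV
    · refine Or.inr ⟨e, t, ⟨lt_of_le_of_ne ht.1 ?_, lt_of_le_of_ne ht.2 ?_⟩, rfl⟩
      · rintro rfl
        exact hV (G.param_zero_mem e)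
      · rintro rfl
        exact hV (G.param_len_mem e)

/-- Functions on the closed edges and on the vertices which agree where they meet glue to a
function on the graph. -/
theorem exists_glue {Y : Type*} (fV : Γ → Y) (f : G.E → ℝ → Y) (h0 : ∀ e, f e 0 = fV (G.src e))
    (h1 : ∀ e, f e (G.len e) = fV (G.tgt e)) :
    ∃ F : Γ → Y, (∀ v ∈ G.V, F v = fV v) ∧ ∀ e, ∀ t ∈ Icc 0 (G.len e), F (G.param e t) = f e t := by
  classical
  have hopen : ∀ p : Γ, ∃ y : Y, (p ∈ G.V → y = fV p) ∧
      ∀ e, ∀ t ∈ Ioo 0 (G.len e), G.param e t = p → y = f e t := by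
    intro p
    rcases G.mem_V_or_openEdge p with hp | ⟨e, t, ht, rfl⟩
    · exact ⟨fV p, fun _ => rfl, fun e t ht h => absurd (h ▸ hp) (G.param_notMem e t ht)⟩
    · refine ⟨f e t, fun h => absurd h (G.param_notMem e t ht), fun e' t' ht' h => ?_⟩
      obtain ⟨rfl, rfl⟩ := G.param_inj e' e t' ht' t ht h
      rfl
  choose F hF using hopen
  have hFV : ∀ v ∈ G.V, F v = fV v := fun v hv => (hF v).1 hv
  refine ⟨F, hFV, fun e t ht => ?_⟩
  rcases ht.1.eq_or_lt with rfl | h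
  · rw [hFV _ (G.param_zero_mem e), h0, src]
  rcases ht.2.eq_or_lt with rfl | h'
  · rw [hFV _ (G.param_len_mem e), h1, tgt]
  exact (hF _).2 e t ⟨h, h'⟩ rfl

theorem continuous_of_edges {Y : Type*} [TopologicalSpace Y] {F : Γ → Y}
    (hF : ∀ e, ContinuousOn (fun t => F (G.param e t)) (Icc 0 (G.len e))) : Continuous F := by
  refine continuous_iff_isClosed.2 fun C hC => ?_
  have h : F ⁻¹' C = ((G.V : Set Γ) ∩ F ⁻¹' C) ∪
      ⋃ e, G.param e '' (Icc 0 (G.len e) ∩ (fun t => F (G.param e t)) ⁻¹' C) := by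
    ext p
    constructor
    · intro hp
      rcases G.cover p with h | ⟨e, t, ht, rfl⟩
      · exact Or.inl ⟨h, hp⟩
      · exact Or.inr (mem_iUnion.2 ⟨e, t, ⟨ht, hp⟩, rfl⟩)
    · rintro (h | h)
      · exact h.2
      · obtain ⟨e, t, ht, rfl⟩ := mem_iUnion.1 h
        exact ht.2
  rw [h]
  refine (G.V.finite_toSet.subset inter_subset_left).isClosed.union
    (isClosed_iUnion_of_finite fun e => ?_)
  have hcl := (hF e).preimage_isClosed_of_isClosed isClosed_Icc hC
  exact ((isCompact_Icc.of_isClosed_subset hcl inter_subset_left).image_of_continuousOn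
    ((G.continuousOn_param e).mono inter_subset_left)).isClosed

theorem isOpen_openEdge (e : G.E) : IsOpen (G.param e '' Ioo 0 (G.len e)) := by
  have h : G.param e '' Ioo 0 (G.len e) =
      ((G.V : Set Γ) ∪ ⋃ e' ∈ {e' | e' ≠ e}, G.param e' '' Icc 0 (G.len e'))ᶜ := by
    ext p
    constructor
    · rintro ⟨t, ht, rfl⟩ (h | h)
      · exact G.param_notMem e t ht h
      · simp only [mem_iUnion] at h
        obtain ⟨e', he', t', ht', h⟩ := h
        have hV : G.param e' t' ∉ G.V := by
          rw [h]
          exact G.param_notMem e t ht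
        have ht'' : t' ∈ Ioo 0 (G.len e') := by
          refine ⟨lt_of_le_of_ne ht'.1 ?_, lt_of_le_of_ne ht'.2 ?_⟩
          · rintro rfl
            exact hV (G.param_zero_mem e')
          · rintro rfl
            exact hV (G.param_len_mem e')
        exact he' (G.param_inj e' e t' ht'' t ht h).1
    · intro hp
      rcases G.mem_V_or_openEdge p with h | ⟨e', t, ht, rfl⟩
      · exact absurd (Or.inl h) hp
      · by_cases he : e' = e
        · subst he
          exact ⟨t, ht, rfl⟩
        · exact (hp (Or.inr (mem_biUnion (show e' ∈ {e' | e' ≠ e} from he)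
            (mem_image_of_mem _ (Ioo_subset_Icc_self ht))))).elim
  rw [h]
  refine IsClosed.isOpen_compl (self := (G.V.finite_toSet.isClosed).union ?_)
  exact (Set.toFinite _).isClosed_biUnion fun e _ =>
    (isCompact_Icc.image_of_continuousOn (G.continuousOn_param e)).isClosed

/-- As soon as there is an edge, no vertex is isolated. -/
theorem exists_param_eq [ConnectedSpace Γ] (e₀ : G.E) (p : Γ) :
    ∃ e, ∃ t ∈ Icc 0 (G.len e), G.param e t = p := by
  set A : Set Γ := ⋃ e, G.param e '' Icc 0 (G.len e) with hA
  have hcl : IsClosed A := isClosed_iUnion_of_finite fun e =>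
    (isCompact_Icc.image_of_continuousOn (G.continuousOn_param e)).isClosed
  have hcl' : IsClosed Aᶜ := by
    refine (G.V.finite_toSet.subset fun p hp => ?_).isClosed
    rcases G.cover p with h | ⟨e, t, ht, rfl⟩
    · exact h
    · exact (hp (mem_iUnion_of_mem e (mem_image_of_mem _ ht))).elim
  have h : A = univ := IsClopen.eq_univ ⟨hcl, isClosed_compl_iff.1 hcl'⟩
    ⟨G.param e₀ 0, mem_iUnion_of_mem e₀ (mem_image_of_mem _ (G.zero_mem_Icc e₀))⟩
  have hp : p ∈ A := h ▸ mem_univ p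
  exact mem_iUnion.1 hp

/-- A function on the vertices with equal values at the ends of each edge is constant. -/
theorem eq_of_edges [ConnectedSpace Γ] {Y : Type*} {h : Γ → Y} (hh : ∀ e, h (G.src e) = h (G.tgt e))
    {v w : Γ} (hv : v ∈ G.V) (hw : w ∈ G.V) : h v = h w := by
  obtain ⟨F, hF, hF'⟩ := G.exists_glue h (fun e _ => h (G.src e)) (fun _ => rfl) hh
  have key : ∀ p c, G.IsPathChain w p c → F p = F w := by
    intro p c hc
    induction hc with
    | refl => rfl
    | move e s t hs ht _ ih => rw [hF' e t ht, ← ih, hF' e s hs]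
  obtain ⟨c, hc⟩ := G.exists_isPathChain w v
  rw [← hF v hv, ← hF w hw, key v c hc]

/-! ### Chains, boundaries and gradients -/

theorem boundary_single (e : G.E) (a : ℝ) : G.boundary (Pi.single e a) =
    a • (Finsupp.single (G.tgt e) (1 : ℝ) - Finsupp.single (G.src e) (1 : ℝ)) := by
  simp [boundary, src, tgt, Fintype.linearCombination_apply_single]

open Classical in
theorem boundary_apply (c : G.E → ℝ) (v : Γ) : G.boundary c v =
    ∑ e, c e * ((if G.tgt e = v then 1 else 0) - (if G.src e = v then 1 else 0)) := by
  simp only [boundary, Fintype.linearCombination_apply, Finsupp.finsetSum_apply,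
    Finsupp.smul_apply, Finsupp.sub_apply, Finsupp.single_apply, src, tgt, smul_eq_mul]
  refine Finset.sum_congr rfl fun e _ => ?_
  congr

/-- The class in `H₁(Γ, ℝ)` of the orthogonal projection of an edge. -/
noncomputable def edgeClass (e : G.E) : G.H1 := G.proj (Pi.single e 1)

theorem proj_eq_sum (c : G.E → ℝ) : G.proj c = ∑ e, c e • G.edgeClass e := by
  conv_lhs => rw [pi_eq_sum_univ' c]
  simp only [map_sum, map_smul, edgeClass]

theorem proj_single (e : G.E) (a : ℝ) : G.proj (Pi.single e a) = a • G.edgeClass e := by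
  rw [edgeClass, ← map_smul, ← Pi.single_smul, smul_eq_mul, mul_one]

theorem proj_coe (z : G.H1) : G.proj (z : G.E → ℝ) = z := by
  have h : G.lengthForm.restrict G.H1 (G.proj (z : G.E → ℝ) - z) = 0 := by
    ext y
    have := G.lengthForm_proj (z : G.E → ℝ) y
    simp [LinearMap.BilinForm.restrict_apply, this]
  have := G.nondegenerate_restrict.1 (G.proj (z : G.E → ℝ) - z) (fun y => by rw [h]; rfl)
  exact sub_eq_zero.1 this

/-- The chains orthogonal to all cycles are the gradients of functions on the vertices. -/
theorem proj_eq_zero_iff (c : G.E → ℝ) :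
    G.proj c = 0 ↔ ∃ h : Γ → ℝ, ∀ e, G.len e * c e = h (G.tgt e) - h (G.src e) := by
  constructor
  · intro hc
    have h1 : G.lengthForm c ∈ G.H1.dualAnnihilator := by
      rw [Submodule.mem_dualAnnihilator]
      intro z hz
      have := G.lengthForm_proj c ⟨z, hz⟩
      rw [hc] at this
      simpa using this.symm
    rw [H1, ← LinearMap.range_dualMap_eq_dualAnnihilator_ker] at h1
    obtain ⟨l, hl⟩ := h1
    refine ⟨fun p => l (Finsupp.single p 1), fun e => ?_⟩
    have h2 := LinearMap.congr_fun hl (Pi.single e 1)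
    rw [LinearMap.dualMap_apply, boundary_single, lengthForm_apply] at h2
    simp only [one_smul, map_sub] at h2
    rw [h2, Finset.sum_eq_single e (fun e' _ he' => by simp [he']) (by simp)]
    simp
  · rintro ⟨h, hh⟩
    have key : ∀ z : G.H1, G.lengthForm c z = 0 := by
      intro z
      let l : (Γ →₀ ℝ) →ₗ[ℝ] ℝ := Finsupp.linearCombination ℝ h
      have h1 : l (G.boundary z) = 0 := by
        rw [LinearMap.mem_ker.1 z.2, map_zero]
      rw [boundary, Fintype.linearCombination_apply, map_sum] at h1
      rw [lengthForm_apply, ← h1]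
      refine Finset.sum_congr rfl fun e _ => ?_
      simp only [l, map_smul, map_sub, Finsupp.linearCombination_single, smul_eq_mul, one_mul]
      have := hh e
      simp only [src, tgt] at this
      rw [← this]
      ring
    refine G.nondegenerate_restrict.1 _ fun z => ?_
    rw [LinearMap.BilinForm.restrict_apply]
    exact (G.lengthForm_proj c z).trans (key z)

/-! ### Chains of paths -/

/-- The pairs `(c, -∂c)` with `c` an integral `1`-chain. Modulo this group, a point of an edge may
be described from either end of the edge: see `exists_chainClass`. -/
def integralGraph : AddSubgroup ((G.E → ℝ) × (Γ →₀ ℝ)) where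
  carrier := {x | (∀ e, ∃ n : ℤ, x.1 e = n) ∧ G.boundary x.1 + x.2 = 0}
  zero_mem' := ⟨fun e => ⟨0, by simp⟩, by simp⟩
  add_mem' := by
    rintro a b ⟨ha, ha'⟩ ⟨hb, hb'⟩
    refine ⟨fun e => ?_, ?_⟩
    · obtain ⟨m, hm⟩ := ha e
      obtain ⟨n, hn⟩ := hb e
      exact ⟨m + n, by simp [hm, hn]⟩
    · rw [Prod.fst_add, Prod.snd_add, map_add, add_add_add_comm, ha', hb', add_zero]
  neg_mem' := by
    rintro a ⟨ha, ha'⟩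
    refine ⟨fun e => ?_, ?_⟩
    · obtain ⟨m, hm⟩ := ha e
      exact ⟨-m, by simp [hm]⟩
    · rw [Prod.fst_neg, Prod.snd_neg, map_neg, ← neg_add, ha', neg_zero]

/-- Each point `p` has a class, represented by `(t / len e) e` together with the initial vertex of
`e` if `p` is the point with parameter `t` on `e`, and the chain of a path is the difference of the
classes of its end points. -/
theorem exists_chainClass : ∃ Θ : Γ → ((G.E → ℝ) × (Γ →₀ ℝ)) ⧸ G.integralGraph,
    (∀ v ∈ G.V, Θ v = QuotientAddGroup.mk (0, Finsupp.single v 1)) ∧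
    ∀ q p c, G.IsPathChain q p c → Θ p - Θ q = QuotientAddGroup.mk (c, 0) := by
  obtain ⟨Θ, h1, h2⟩ := G.exists_glue
    (Y := ((G.E → ℝ) × (Γ →₀ ℝ)) ⧸ G.integralGraph)
    (fun v => QuotientAddGroup.mk (0, Finsupp.single v 1))
    (fun e t => QuotientAddGroup.mk (Pi.single e (t / G.len e), Finsupp.single (G.src e) 1))
    (fun e => by simp) (fun e => by
      rw [QuotientAddGroup.eq, div_self (G.len_pos e).ne']
      refine ⟨fun e' => ?_, ?_⟩
      · rcases eq_or_ne e' e with rfl | he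
        · exact ⟨-1, by simp⟩
        · exact ⟨0, by simp [he]⟩
      · simp [boundary_single])
  refine ⟨Θ, h1, fun q p c hc => ?_⟩
  induction hc with
  | refl =>
    rw [sub_self]
    rfl
  | move e s t hs ht _ ih =>
    rw [h2 e s hs] at ih
    rw [sub_eq_iff_eq_add] at ih ⊢
    have h3 : Θ (G.param e t) = Θ (G.param e s) +
        QuotientAddGroup.mk (Pi.single e ((t - s) / G.len e), 0) := by
      rw [h2 e t ht, h2 e s hs, ← QuotientAddGroup.mk_add, Prod.mk_add_mk, ← Pi.single_add,
        add_zero, ← add_div, add_sub_cancel]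
    have h4 : ∀ a b : G.E → ℝ, (QuotientAddGroup.mk (a + b, 0) :
        ((G.E → ℝ) × (Γ →₀ ℝ)) ⧸ G.integralGraph) =
        QuotientAddGroup.mk (a, 0) + QuotientAddGroup.mk (b, 0) := fun a b => by
      rw [← QuotientAddGroup.mk_add, Prod.mk_add_mk, add_zero]
    rw [h3, h2 e s hs, ih, h4]
    exact add_right_comm (G := ((G.E → ℝ) × (Γ →₀ ℝ)) ⧸ G.integralGraph) _ _ _

theorem isPathChain_proj_sub_mem {q p : Γ} {c c' : G.E → ℝ} (hc : G.IsPathChain q p c)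
    (hc' : G.IsPathChain q p c') : G.proj c - G.proj c' ∈ G.H1Int := by
  obtain ⟨Θ, -, hΘ⟩ := G.exists_chainClass
  have h := (hΘ q p c' hc').symm.trans (hΘ q p c hc)
  rw [QuotientAddGroup.eq] at h
  obtain ⟨h1, h2⟩ := h
  simp only [Prod.fst_add, Prod.fst_neg, Prod.snd_add, Prod.snd_neg, neg_zero, add_zero] at h1 h2
  have h3 := G.proj_coe ⟨-c' + c, h2⟩
  rw [← map_sub, sub_eq_neg_add]
  rw [h3]
  exact h1

/-- The chains of paths from a common point to two vertices differ by an integral chain. -/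
theorem isPathChain_sub_integral {q v w : Γ} (hv : v ∈ G.V) (hw : w ∈ G.V) {c c' : G.E → ℝ}
    (hc : G.IsPathChain q v c) (hc' : G.IsPathChain q w c') :
    (∀ e, ∃ n : ℤ, (c - c') e = n) ∧
      G.boundary (c - c') = Finsupp.single v 1 - Finsupp.single w 1 := by
  obtain ⟨Θ, hV, hΘ⟩ := G.exists_chainClass
  have h : (QuotientAddGroup.mk ((0, Finsupp.single v 1) + (c', 0)) :
      ((G.E → ℝ) × (Γ →₀ ℝ)) ⧸ G.integralGraph) =
      QuotientAddGroup.mk ((0, Finsupp.single w 1) + (c, 0)) := by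
    rw [QuotientAddGroup.mk_add, QuotientAddGroup.mk_add, ← hΘ q v c hc, ← hΘ q w c' hc', hV v hv,
      hV w hw]
    exact add_sub_left_comm (α := ((G.E → ℝ) × (Γ →₀ ℝ)) ⧸ G.integralGraph) _ _ _
  rw [QuotientAddGroup.eq] at h
  obtain ⟨h1, h2⟩ := h
  have h3 : (-((0, Finsupp.single v 1) + (c', 0)) + ((0, Finsupp.single w 1) + (c, 0)) :
    (G.E → ℝ) × (Γ →₀ ℝ)) = (c - c', Finsupp.single w 1 - Finsupp.single v 1) := by
    ext <;> simp <;> ring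
  rw [h3] at h1 h2
  exact ⟨h1, by rw [eq_neg_of_add_eq_zero_left h2, neg_sub]⟩

/-! ### The Jacobian -/

theorem countable_H1Int : Countable G.H1Int := by
  choose f hf using fun z : G.H1Int => z.2
  refine Function.Injective.countable (f := f) fun z w h => ?_
  ext e
  rw [hf z e, hf w e, h]

instance : T2Space G.Jac := by
  have : IsClosed (G.H1Int : Set G.H1) := by
    have h : (G.H1Int : Set G.H1) =
        ⋂ e, (fun z : G.H1 => (z : G.E → ℝ) e) ⁻¹' range ((↑) : ℤ → ℝ) := by
      ext z
      simp only [mem_iInter, mem_preimage, mem_range]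
      exact forall_congr' fun e => exists_congr fun n => eq_comm
    rw [h]
    refine isClosed_iInter fun e => Int.isClosedEmbedding_coe_real.isClosed_range.preimage ?_
    exact (continuous_apply e).comp continuous_subtype_val
  infer_instance

/-! ### The Abel–Jacobi map on points -/

variable [ConnectedSpace Γ]

/-- A lift to `H₁(Γ, ℝ)` of the value of the Abel–Jacobi map at the initial vertex of an edge. -/
noncomputable def baseLift (q : Γ) (e : G.E) : G.H1 :=
  G.proj (G.exists_isPathChain q (G.src e)).choose

theorem pointToJac_eq {q p : Γ} {c : G.E → ℝ} (hc : G.IsPathChain q p c) :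
    G.pointToJac q p = QuotientAddGroup.mk (G.proj c) := by
  rw [pointToJac, QuotientAddGroup.eq, ← sub_eq_neg_add]
  exact G.isPathChain_proj_sub_mem hc (G.exists_isPathChain q p).choose_spec

theorem pointToJac_param (q : Γ) (e : G.E) {t : ℝ} (ht : t ∈ Icc 0 (G.len e)) :
    G.pointToJac q (G.param e t) =
      QuotientAddGroup.mk (G.baseLift q e + (t / G.len e) • G.edgeClass e) := by
  have h := (G.exists_isPathChain q (G.src e)).choose_spec.move e 0 t (G.zero_mem_Icc e) ht
  rw [G.pointToJac_eq h, map_add, sub_zero, proj_single, baseLift]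

theorem continuous_pointToJac (q : Γ) : Continuous (G.pointToJac q) := by
  refine G.continuous_of_edges fun e => ?_
  have h : ContinuousOn (fun t : ℝ => (QuotientAddGroup.mk
      (G.baseLift q e + (t / G.len e) • G.edgeClass e) : G.Jac)) (Icc 0 (G.len e)) := by
    have : Continuous fun t : ℝ => G.baseLift q e + (t / G.len e) • G.edgeClass e := by fun_prop
    exact (QuotientAddGroup.continuous_mk.comp this).continuousOn
  exact h.congr fun t ht => G.pointToJac_param q e ht

end MetricGraph

/-! ### Principal divisors have trivial image in the Jacobian -/

/-- `s` records the incoming slopes of `f` on the interval `[a, b]`: those of the right-hand ends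
of the pieces of `f` with positive sign, and those of the left-hand ends with negative sign. The two
sums say that this divisor has degree `0`, and compute its first moment. -/
theorem exists_slopeDivisor {f : ℝ → ℝ} {S : Finset ℝ} {a b : ℝ} (hab : a < b)
    (hS : ∀ a' b', a ≤ a' → b' ≤ b → Disjoint (Ioo a' b') (S : Set ℝ) →
      ∃ (m : ℤ) (c : ℝ), ∀ t ∈ Icc a' b', f t = m * t + c) :
    ∃ s : ℝ →₀ ℤ, (∀ τ, (s τ : ℝ) = (if τ ∈ Ioc a b then derivWithin f (Iio τ) τ else 0) +
        if τ ∈ Ico a b then -derivWithin f (Ioi τ) τ else 0) ∧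
      (s.sum fun _ n => n) = 0 ∧ (s.sum fun τ n => (n : ℝ) * τ) = f b - f a := by
  classical
  induction h : (S.filter (· ∈ Ioo a b)).card using Nat.strong_induction_on generalizing a b with
  | _ N ih =>
  rcases (S.filter (· ∈ Ioo a b)).eq_empty_or_nonempty with he | ⟨σ, hσ⟩
  · obtain ⟨m, c, hm⟩ := hS a b le_rfl le_rfl (by
      rw [Set.disjoint_left]
      intro x hx hxS
      exact Finset.eq_empty_iff_forall_notMem.1 he x (Finset.mem_filter.2 ⟨hxS, hx⟩))
    have hl : ∀ τ ∈ Ioc a b, derivWithin f (Iio τ) τ = m := by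
      intro τ hτ
      have h1 : HasDerivWithinAt (fun t : ℝ => (m : ℝ) * t + c) m (Iio τ) τ := by
        simpa using ((hasDerivWithinAt_id τ (Iio τ)).const_mul (m : ℝ)).add_const c
      refine (h1.congr_of_eventuallyEq ?_ (hm τ ⟨hτ.1.le, hτ.2⟩)).derivWithin
        (uniqueDiffWithinAt_Iio τ)
      filter_upwards [Ioo_mem_nhdsLT hτ.1] with x hx
      exact hm x ⟨hx.1.le, hx.2.le.trans hτ.2⟩
    have hr : ∀ τ ∈ Ico a b, derivWithin f (Ioi τ) τ = m := by
      intro τ hτ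
      have h1 : HasDerivWithinAt (fun t : ℝ => (m : ℝ) * t + c) m (Ioi τ) τ := by
        simpa using ((hasDerivWithinAt_id τ (Ioi τ)).const_mul (m : ℝ)).add_const c
      refine (h1.congr_of_eventuallyEq ?_ (hm τ ⟨hτ.1, hτ.2.le⟩)).derivWithin
        (uniqueDiffWithinAt_Ioi τ)
      filter_upwards [Ioo_mem_nhdsGT hτ.2] with x hx
      exact hm x ⟨hτ.1.trans hx.1.le, hx.2.le⟩
    refine ⟨Finsupp.single b m - Finsupp.single a m, fun τ => ?_, ?_, ?_⟩
    · have e1 : (if τ ∈ Ioc a b then derivWithin f (Iio τ) τ else 0) =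
          if τ ∈ Ioc a b then (m : ℝ) else 0 := by
        split_ifs with hτ
        · exact hl τ hτ
        · rfl
      have e2 : (if τ ∈ Ico a b then -derivWithin f (Ioi τ) τ else 0) =
          if τ ∈ Ico a b then -(m : ℝ) else 0 := by
        split_ifs with hτ
        · rw [hr τ hτ]
        · rfl
      rw [e1, e2, Finsupp.sub_apply, Finsupp.single_apply, Finsupp.single_apply]
      simp only [mem_Ioc, mem_Ico]
      rcases lt_trichotomy τ a with h1 | rfl | h1
      · simp [h1.ne', h1.not_gt, h1.not_ge, (h1.trans hab).ne']
      · simp [hab, hab.ne']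
      · rcases lt_trichotomy τ b with h2 | rfl | h2
        · simp [h1, h1.le, h2, h2.le, h1.ne, h2.ne']
        · simp [hab, hab.ne]
        · simp [h2.not_gt, h2.not_ge, h2.ne, h1.ne]
    · rw [Finsupp.sum_sub_index (fun _ _ _ => rfl)]
      simp
    · rw [Finsupp.sum_sub_index (fun _ _ _ => by push_cast; ring)]
      simp only [Int.cast_zero, zero_mul, Finsupp.sum_single_index]
      rw [hm b ⟨hab.le, le_rfl⟩, hm a ⟨le_rfl, hab.le⟩]
      ring
  · obtain ⟨hσS, h1, h2⟩ := Finset.mem_filter.1 hσ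
    obtain ⟨s, hs, hs0, hs1⟩ := ih _ (by
      rw [← h]
      refine Finset.card_lt_card ⟨fun x hx => ?_, fun hsub => ?_⟩
      · simp only [Finset.mem_filter, mem_Ioo] at hx ⊢
        exact ⟨hx.1, hx.2.1, hx.2.2.trans h2⟩
      · have := hsub hσ
        simp at this) h1 (fun a' b' ha hb => hS a' b' ha (hb.trans h2.le)) rfl
    obtain ⟨s', hs', hs0', hs1'⟩ := ih _ (by
      rw [← h]
      refine Finset.card_lt_card ⟨fun x hx => ?_, fun hsub => ?_⟩
      · simp only [Finset.mem_filter, mem_Ioo] at hx ⊢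
        exact ⟨hx.1, h1.trans hx.2.1, hx.2.2⟩
      · have := hsub hσ
        simp at this) h2 (fun a' b' ha hb => hS a' b' (h1.le.trans ha) hb) rfl
    refine ⟨s + s', fun τ => ?_, ?_, ?_⟩
    · rw [Finsupp.add_apply, Int.cast_add, hs, hs']
      simp only [mem_Ioc, mem_Ico]
      rcases lt_trichotomy τ σ with h3 | rfl | h3
      · simp [h3, h3.le, h3.not_gt, h3.not_ge, h3.trans h2, (h3.trans h2).le]
      · simp [h1, h2, h1.le, h2.le]
      · simp [h3, h3.le, h3.not_gt, h3.not_ge, h1.trans h3, (h1.trans h3).le]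
    · rw [Finsupp.sum_add_index' (fun _ => rfl) (fun _ _ _ => rfl), hs0, hs0', add_zero]
    · rw [Finsupp.sum_add_index' (fun _ => by simp) (fun _ _ _ => by push_cast; ring), hs1, hs1']
      ring

namespace MetricGraph

variable {Γ : Type*} [MetricSpace Γ] (G : MetricGraph Γ)

open Classical in
theorem finsum_mem_eq_sum_ite {ι : Type*} {A : Set ι} {F : Finset ι} (h : A ⊆ F) (g : ι → ℝ) :
    ∑ᶠ t ∈ A, g t = ∑ t ∈ F, if t ∈ A then g t else 0 := by
  rw [finsum_mem_eq_sum_of_subset (s := A) (t := F.filter (· ∈ A)), Finset.sum_filter]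
  · intro x hx
    simpa using ⟨h hx.1, hx.1⟩
  · intro x hx
    simpa using (Finset.mem_filter.1 (Finset.mem_coe.1 hx)).2

/-- A principal divisor decomposes into contributions of degree `0` of the closed edges. -/
theorem principal_eq_sum {φ : Γ → ℝ} (hφ : G.IsRational φ) {D : Divisor Γ}
    (hD : ∀ p, (D p : ℝ) = G.incomingSlopes φ p) : ∃ s : G.E → ℝ →₀ ℤ,
    (∀ e, ∀ τ ∈ (s e).support, τ ∈ Icc 0 (G.len e)) ∧ (∀ e, ((s e).sum fun _ n => n) = 0) ∧
    (∀ e, ((s e).sum fun τ n => (n : ℝ) * τ) = φ (G.tgt e) - φ (G.src e)) ∧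
    D = ∑ e, (s e).mapDomain (G.param e) := by
  classical
  choose S hS using hφ.isIntegralPL
  choose s hs hs0 hs1 using fun e => exists_slopeDivisor (G.len_pos e) (hS e)
  have hsupp : ∀ e, ∀ τ, s e τ ≠ 0 → τ ∈ Icc 0 (G.len e) := by
    intro e τ hτ
    by_contra hn
    have h1 : τ ∉ Ioc 0 (G.len e) := fun h => hn (Ioc_subset_Icc_self h)
    have h2 : τ ∉ Ico 0 (G.len e) := fun h => hn (Ico_subset_Icc_self h)
    have := hs e τ
    rw [if_neg h1, if_neg h2, add_zero, Int.cast_eq_zero] at this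
    exact hτ this
  refine ⟨s, fun e τ hτ => hsupp e τ (Finsupp.mem_support_iff.1 hτ), hs0, hs1, ?_⟩
  ext p
  rw [← Int.cast_inj (α := ℝ), hD, incomingSlopes, Finsupp.finsetSum_apply, Int.cast_sum]
  refine Finset.sum_congr rfl fun e _ => ?_
  set F := (G.finite_fiber e p).toFinset with hF
  have hFm : ∀ t, t ∈ F ↔ t ∈ Icc 0 (G.len e) ∧ G.param e t = p := fun t => by simp [hF]
  rw [finsum_mem_eq_sum_ite (F := F) (fun t ht =>
      Finset.mem_coe.2 ((hFm t).2 ⟨Ioc_subset_Icc_self ht.1, ht.2⟩)),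
    finsum_mem_eq_sum_ite (F := F) (fun t ht =>
      Finset.mem_coe.2 ((hFm t).2 ⟨Ico_subset_Icc_self ht.1, ht.2⟩)), ← Finset.sum_add_distrib]
  have h1 : (s e).mapDomain (G.param e) p = ∑ t ∈ F, s e t := by
    rw [Finsupp.mapDomain, Finsupp.sum, Finsupp.finsetSum_apply]
    simp only [Finsupp.single_apply]
    rw [← Finset.sum_filter]
    refine Finset.sum_subset (fun t ht => ?_) fun t ht ht' => ?_
    · obtain ⟨h, h'⟩ := Finset.mem_filter.1 ht
      exact (hFm t).2 ⟨hsupp e t (Finsupp.mem_support_iff.1 h), h'⟩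
    · by_contra hne
      exact ht' (Finset.mem_filter.2 ⟨Finsupp.mem_support_iff.2 hne, ((hFm t).1 ht).2⟩)
  rw [h1, Int.cast_sum]
  refine Finset.sum_congr rfl fun t ht => ?_
  rw [hs e t]
  simp [((hFm t).1 ht).2]

variable [ConnectedSpace Γ]

theorem divisorToJac_eq (q : Γ) (D : Divisor Γ) :
    G.divisorToJac q D = Finsupp.linearCombination ℤ (G.pointToJac q) D := rfl

/-- The easy half of the tropical Abel–Jacobi theorem: the image of `div φ` is the class of the
projection of the gradient of `φ`, which is orthogonal to all cycles. -/
theorem divisorToJac_principal (q : Γ) {D : Divisor Γ} (hD : D ∈ G.principal) :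
    G.divisorToJac q D = 0 := by
  obtain ⟨φ, hφ, h⟩ := hD
  obtain ⟨s, hs, hs0, hs1, rfl⟩ := G.principal_eq_sum hφ h
  rw [divisorToJac_eq, map_sum]
  have key : ∀ e, Finsupp.linearCombination ℤ (G.pointToJac q) ((s e).mapDomain (G.param e)) =
      QuotientAddGroup.mk' G.H1Int
        (((φ (G.tgt e) - φ (G.src e)) / G.len e) • G.edgeClass e) := by
    intro e
    rw [Finsupp.linearCombination_mapDomain, Finsupp.linearCombination_apply, Finsupp.sum]
    have h1 : ∀ τ ∈ (s e).support, s e τ • (G.pointToJac q ∘ G.param e) τ =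
        QuotientAddGroup.mk' G.H1Int
          (s e τ • G.baseLift q e + ((s e τ * τ) / G.len e) • G.edgeClass e) := by
      intro τ hτ
      rw [Function.comp_apply, G.pointToJac_param q e (hs e τ hτ), ← QuotientAddGroup.mk'_apply,
        ← map_zsmul, smul_add, ← Int.cast_smul_eq_zsmul ℝ (s e τ) (_ • G.edgeClass e), smul_smul,
        mul_div_assoc]
    rw [Finset.sum_congr rfl h1, ← map_sum, Finset.sum_add_distrib, ← Finset.sum_smul,
      ← Finset.sum_smul, ← Finset.sum_div]
    have h2 := hs0 e
    have h3 := hs1 e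
    rw [Finsupp.sum] at h2 h3
    rw [h2, h3, zero_smul, zero_add]
  rw [Finset.sum_congr rfl fun e _ => key e, ← map_sum,
    ← G.proj_eq_sum fun e => (φ (G.tgt e) - φ (G.src e)) / G.len e,
    (G.proj_eq_zero_iff _).2 ⟨φ, fun e => mul_div_cancel₀ _ (G.len_pos e).ne'⟩, map_zero]

theorem picToJac_abelJacobi (q : Γ) (d : ℕ) (D : EffDivisor Γ d) :
    G.picToJac q d (G.abelJacobi d D) = G.divisorToJac q D.1 := by
  have h : G.linearEquiv d (Quotient.out (G.abelJacobi d D)) D.toDivisorDeg :=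
    Quotient.mk_out (s := G.linearEquiv d) D.toDivisorDeg
  have h1 : -(Quotient.out (G.abelJacobi d D)).1 + D.1 ∈ G.principal :=
    QuotientAddGroup.leftRel_apply.1 h
  have h2 := G.divisorToJac_principal q h1
  rw [divisorToJac_eq, map_add, map_neg, neg_add_eq_zero] at h2
  exact h2

theorem divisorToJac_ofTuple (q : Γ) {d : ℕ} (x : Fin d → Γ) :
    G.divisorToJac q (EffDivisor.ofTuple Γ d x).1 = ∑ i, G.pointToJac q (x i) := by
  rw [divisorToJac_eq, EffDivisor.ofTuple, map_sum]
  simp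

end MetricGraph

namespace MetricGraph

variable {Γ : Type*} [MetricSpace Γ] (G : MetricGraph Γ)

/-! ### Independent edges -/

/-- Independent edge classes mean that the complement of the edges is connected: a function on
the vertices which is constant along all other edges is constant along all edges. -/
theorem eq_of_linearIndependent {ι : Type*} [Fintype ι] {e : ι → G.E}
    (he : LinearIndependent ℝ fun i => G.edgeClass (e i)) {h : Γ → ℝ}
    (hh : ∀ ε ∉ range e, h (G.src ε) = h (G.tgt ε)) (ε : G.E) : h (G.src ε) = h (G.tgt ε) := by
  by_cases hε : ε ∈ range e
  · obtain ⟨i, rfl⟩ := hε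
    have hinj : Function.Injective e := fun i j hij => he.injective (congrArg G.edgeClass hij)
    have h1 : G.proj (fun ε => (h (G.tgt ε) - h (G.src ε)) / G.len ε) = 0 :=
      (G.proj_eq_zero_iff _).2 ⟨h, fun ε => mul_div_cancel₀ _ (G.len_pos ε).ne'⟩
    rw [proj_eq_sum, ← Finset.sum_subset (Finset.subset_univ (Finset.univ.image e)),
      Finset.sum_image hinj.injOn] at h1
    · have h2 := Fintype.linearIndependent_iff.1 he _ h1 i
      rcases div_eq_zero_iff.1 h2 with h2 | h2
      · exact (sub_eq_zero.1 h2).symm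
      · exact absurd h2 (G.len_pos _).ne'
    · intro ε _ hε
      rw [hh ε fun ⟨i, hi⟩ => hε (Finset.mem_image.2 ⟨i, Finset.mem_univ i, hi⟩), sub_self,
        zero_div, zero_smul]
  · exact hh ε hε

theorem linearIndependent_of_forall {ι : Type*} [Fintype ι] {e : ι → G.E}
    (hinj : Function.Injective e)
    (he : ∀ h : Γ → ℝ, (∀ ε ∉ range e, h (G.src ε) = h (G.tgt ε)) →
      ∀ ε, h (G.src ε) = h (G.tgt ε)) :
    LinearIndependent ℝ fun i => G.edgeClass (e i) := by
  rw [Fintype.linearIndependent_iff]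
  intro a ha i
  have h1 : ∀ ε, (∑ i, Pi.single (e i) (a i) : G.E → ℝ) ε = ∑ i, if e i = ε then a i else 0 := by
    intro ε
    rw [Finset.sum_apply]
    refine Finset.sum_congr rfl fun i _ => ?_
    rw [Pi.single_apply]
    simp only [eq_comm]
  have h2 : G.proj (∑ i, Pi.single (e i) (a i)) = 0 := by
    rw [map_sum, ← ha]
    exact Finset.sum_congr rfl fun i _ => G.proj_single _ _
  obtain ⟨h, hh⟩ := (G.proj_eq_zero_iff _).1 h2
  have h3 := hh (e i)
  rw [he h (fun ε hε => ?_) (e i), sub_self, h1, Finset.sum_eq_single i, if_pos rfl] at h3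
  · exact (mul_eq_zero.1 h3).resolve_left (G.len_pos _).ne'
  · intro j _ hj
    rw [if_neg fun h => hj (hinj h)]
  · simp
  · have h4 := hh ε
    rw [h1, Finset.sum_eq_zero, mul_zero] at h4
    · linarith
    · intro j _
      rw [if_neg fun h => hε ⟨j, h⟩]

variable [ConnectedSpace Γ]

theorem V_nonempty : G.V.Nonempty := by
  obtain ⟨p⟩ := (inferInstance : Nonempty Γ)
  rcases G.cover p with h | ⟨e, -⟩
  · exact ⟨p, h⟩
  · exact ⟨_, G.src_mem e⟩

/-! ### Rigidity of divisors on independent edges -/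

open Classical in
/-- Two effective divisors with the same image in the Jacobian differ by a principal divisor. Here
the corresponding rational function is given by its values `h` on the vertices, and on an edge by
its slope `n` beyond all chips. -/
theorem exists_potential {q : Γ} {d : ℕ} {e e' : Fin d → G.E} {t t' : Fin d → ℝ}
    (ht : ∀ i, t i ∈ Icc 0 (G.len (e i))) (ht' : ∀ i, t' i ∈ Icc 0 (G.len (e' i)))
    (hΦ : ∑ i, G.pointToJac q (G.param (e i) (t i)) = ∑ i, G.pointToJac q (G.param (e' i) (t' i))) :
    ∃ (n : G.E → ℤ) (h : Γ → ℝ),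
      (∀ ε, h (G.tgt ε) - h (G.src ε) = n ε * G.len ε + (∑ i, if e i = ε then t i else 0) -
        ∑ i, if e' i = ε then t' i else 0) ∧
      ∀ v, ∑ ε, n ε * ((if G.tgt ε = v then 1 else 0) - if G.src ε = v then 1 else 0) =
        (∑ i, if G.src (e i) = v then 1 else 0) - ∑ i, if G.src (e' i) = v then 1 else 0 := by
  set c : G.E → G.E → ℝ := fun ε => (G.exists_isPathChain q (G.src ε)).choose with hcdef
  have hc : ∀ ε, G.IsPathChain q (G.src ε) (c ε) := fun ε =>
    (G.exists_isPathChain q (G.src ε)).choose_spec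
  have hb : ∀ ε, G.baseLift q ε = G.proj (c ε) := fun ε => rfl
  have hlift : ∀ (e : Fin d → G.E) (t : Fin d → ℝ), (∀ i, t i ∈ Icc 0 (G.len (e i))) →
      ∑ i, G.pointToJac q (G.param (e i) (t i)) = QuotientAddGroup.mk (G.proj
        (∑ i, c (e i) + ∑ i, Pi.single (e i) (t i / G.len (e i)))) := by
    intro e t ht
    rw [map_add, map_sum, map_sum, ← Finset.sum_add_distrib, ← QuotientAddGroup.mk'_apply, map_sum]
    refine Finset.sum_congr rfl fun i _ => ?_
    rw [G.pointToJac_param q (e i) (ht i), hb, proj_single, QuotientAddGroup.mk'_apply]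
  rw [hlift e t ht, hlift e' t' ht', QuotientAddGroup.eq] at hΦ
  obtain ⟨z, hz⟩ : ∃ z, z = -G.proj (∑ i, c (e i) + ∑ i, Pi.single (e i) (t i / G.len (e i))) +
      G.proj (∑ i, c (e' i) + ∑ i, Pi.single (e' i) (t' i / G.len (e' i))) := ⟨_, rfl⟩
  rw [← hz] at hΦ
  set m : G.E → ℝ := ∑ i, (c (e i) - c (e' i)) + z with hm
  have hsingle : ∀ (e : Fin d → G.E) (t : Fin d → ℝ) ε,
      (∑ i, Pi.single (e i) (t i / G.len (e i)) : G.E → ℝ) ε =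
        (∑ i, if e i = ε then t i else 0) / G.len ε := by
    intro e t ε
    rw [Finset.sum_apply, Finset.sum_div]
    refine Finset.sum_congr rfl fun i _ => ?_
    rcases eq_or_ne (e i) ε with rfl | h
    · simp
    · simp [h, h.symm]
  have hw : G.proj (m + ∑ i, Pi.single (e i) (t i / G.len (e i)) -
      ∑ i, Pi.single (e' i) (t' i / G.len (e' i))) = 0 := by
    rw [hm, Finset.sum_sub_distrib, map_sub, map_add, map_add, map_sub, proj_coe, hz, map_add,
      map_add]
    abel
  obtain ⟨h, hh⟩ := (G.proj_eq_zero_iff _).1 hw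
  have hint : ∀ ε, ∃ n : ℤ, m ε = n := by
    intro ε
    choose k hk using fun i => (G.isPathChain_sub_integral (G.src_mem (e i)) (G.src_mem (e' i))
      (hc (e i)) (hc (e' i))).1 ε
    obtain ⟨l, hl⟩ := hΦ ε
    refine ⟨∑ i, k i + l, ?_⟩
    rw [hm, Pi.add_apply, Finset.sum_apply, hl]
    simp [hk]
  choose n hn using hint
  refine ⟨n, h, fun ε => ?_, fun v => ?_⟩
  · rw [← hh ε, Pi.sub_apply, Pi.add_apply, hsingle, hsingle, hn]
    have := (G.len_pos ε).ne'
    field_simp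
  · have h1 : G.boundary m v = ∑ i, ((if G.src (e i) = v then 1 else 0) -
        if G.src (e' i) = v then 1 else 0) := by
      rw [hm, map_add, LinearMap.mem_ker.1 z.2, add_zero, map_sum, Finsupp.finsetSum_apply]
      refine Finset.sum_congr rfl fun i _ => ?_
      rw [(G.isPathChain_sub_integral (G.src_mem (e i)) (G.src_mem (e' i))
        (hc (e i)) (hc (e' i))).2, Finsupp.sub_apply, Finsupp.single_apply, Finsupp.single_apply]
    rw [boundary_apply] at h1
    simp only [hn] at h1
    rw [← Finset.sum_sub_distrib]
    have h2 : ((∑ ε, n ε * ((if G.tgt ε = v then 1 else 0) - if G.src ε = v then 1 else 0) : ℤ) : ℝ)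
        = ((∑ i, ((if G.src (e i) = v then 1 else 0) -
        if G.src (e' i) = v then 1 else 0) : ℤ) : ℝ) := by
      push_cast
      exact h1
    exact_mod_cast h2

/-- If the chips `t i` lie in the interiors of independent edges, no other effective divisor
has the same image in the Jacobian. -/
theorem rigid {q : Γ} {d : ℕ} {e e' : Fin d → G.E} {t t' : Fin d → ℝ}
    (he : LinearIndependent ℝ fun i => G.edgeClass (e i))
    (ht : ∀ i, t i ∈ Ioo 0 (G.len (e i))) (ht' : ∀ i, t' i ∈ Icc 0 (G.len (e' i)))
    (hΦ : ∑ i, G.pointToJac q (G.param (e i) (t i)) = ∑ i, G.pointToJac q (G.param (e' i) (t' i))) :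
    EffDivisor.ofTuple Γ d (fun i => G.param (e i) (t i)) =
      EffDivisor.ofTuple Γ d (fun i => G.param (e' i) (t' i)) := by
  classical
  obtain ⟨n, h, hh, hn⟩ := G.exists_potential (fun i => Ioo_subset_Icc_self (ht i)) ht' hΦ
  have hinj : Function.Injective e := fun i j hij => he.injective (congrArg G.edgeClass hij)
  -- the outgoing slopes of the rational function at the two ends of an edge
  set a : G.E → ℤ := fun ε => n ε + (∑ i, if e i = ε then 1 else 0) -
    ∑ i, if e' i = ε ∧ 0 < t' i then 1 else 0 with ha
  set b : G.E → ℤ := fun ε => -n ε + ∑ i, if e' i = ε ∧ t' i = G.len ε then 1 else 0 with hb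
  have hchip : ∀ ε, (ε ∉ range e ∧ (∑ i, if e i = ε then (1 : ℤ) else 0) = 0 ∧
        (∑ i, if e i = ε then t i else 0) = 0) ∨
      (∃ i, e i = ε ∧ (∑ i, if e i = ε then (1 : ℤ) else 0) = 1 ∧
        (∑ i, if e i = ε then t i else 0) = t i) := by
    intro ε
    by_cases hε : ε ∈ range e
    · obtain ⟨i, rfl⟩ := hε
      exact Or.inr ⟨i, rfl, by simp [hinj.eq_iff], by simp [hinj.eq_iff]⟩
    · refine Or.inl ⟨hε, ?_, ?_⟩ <;>
      · refine Finset.sum_eq_zero fun i _ => ?_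
        rw [if_neg fun h => hε ⟨i, h⟩]
  have hP : ∀ ε, (∑ i, if e' i = ε then t' i else 0) ≤
      ((∑ i, if e' i = ε ∧ 0 < t' i then 1 else 0 : ℤ) : ℝ) * G.len ε := by
    intro ε
    rw [Int.cast_sum, Finset.sum_mul]
    refine Finset.sum_le_sum fun i _ => ?_
    by_cases h1 : e' i = ε
    · subst h1
      rcases (ht' i).1.eq_or_lt with h2 | h2
      · simp [← h2]
      · simpa [h2] using (ht' i).2
    · simp [h1]
  have hQ : ∀ ε, ((∑ i, if e' i = ε ∧ t' i = G.len ε then 1 else 0 : ℤ) : ℝ) * G.len ε ≤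
      ∑ i, if e' i = ε then t' i else 0 := by
    intro ε
    rw [Int.cast_sum, Finset.sum_mul]
    refine Finset.sum_le_sum fun i _ => ?_
    by_cases h1 : e' i = ε
    · subst h1
      by_cases h2 : t' i = G.len (e' i)
      · simp [h2]
      · simpa [h2] using (ht' i).1
    · simp [h1]
  -- A positive outgoing slope is at least `1`. It may drop by `1` at the chip `t i`, and only there,
  -- hence the function is larger at the other end. This needs `t i` to be an interior point.
  have ha_le : ∀ ε, h (G.tgt ε) ≤ h (G.src ε) → a ε ≤ 0 := by
    intro ε hε
    by_contra! hpos
    have h1 : (1 : ℝ) ≤ a ε := by exact_mod_cast hpos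
    have h2 := hh ε
    have h3 := hP ε
    have h4 := G.len_pos ε
    simp only [ha, Int.cast_sub, Int.cast_add] at h1
    rcases hchip ε with ⟨-, hk, hT⟩ | ⟨i, rfl, hk, hT⟩
    · rw [hk] at h1
      rw [hT] at h2
      push_cast at h1 h3
      nlinarith
    · rw [hk] at h1
      rw [hT] at h2
      have := (ht i).1
      push_cast at h1 h3
      nlinarith
  have hb_le : ∀ ε, h (G.src ε) ≤ h (G.tgt ε) → b ε ≤ 0 := by
    intro ε hε
    by_contra! hpos
    have h1 : (1 : ℝ) ≤ b ε := by exact_mod_cast hpos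
    have h2 := hh ε
    have h3 := hQ ε
    have h4 := G.len_pos ε
    simp only [hb, Int.cast_neg, Int.cast_add] at h1
    rcases hchip ε with ⟨-, hk, hT⟩ | ⟨i, rfl, hk, hT⟩
    · rw [hT] at h2
      push_cast at h1 h3
      nlinarith
    · rw [hT] at h2
      have := (ht i).2
      push_cast at h1 h3
      nlinarith
  -- the outgoing slopes at a vertex add up to the number of chips of the second divisor there,
  -- as the first divisor has no chips at the vertices
  have hsum : ∀ v, ∑ ε, ((if G.src ε = v then a ε else 0) + if G.tgt ε = v then b ε else 0) =
      ∑ i, ((if G.src (e' i) = v ∧ ¬0 < t' i then 1 else 0) +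
        if G.tgt (e' i) = v ∧ t' i = G.len (e' i) then 1 else 0) := by
    intro v
    have e1 : ∀ ε, ((if G.src ε = v then a ε else 0) + if G.tgt ε = v then b ε else 0) =
        -(n ε * ((if G.tgt ε = v then 1 else 0) - if G.src ε = v then 1 else 0)) +
        (∑ i, if e i = ε then (if G.src ε = v then 1 else 0) else 0) -
        (∑ i, if e' i = ε then (if G.src ε = v ∧ 0 < t' i then 1 else 0) else 0) +
        ∑ i, if e' i = ε then (if G.tgt ε = v ∧ t' i = G.len ε then 1 else 0) else 0 := by
      intro ε
      simp only [ha, hb]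
      by_cases h1 : G.src ε = v <;> by_cases h2 : G.tgt ε = v <;>
        simp [h1, h2, ite_and] <;> ring
    rw [Finset.sum_congr rfl fun ε _ => e1 ε, Finset.sum_add_distrib, Finset.sum_sub_distrib,
      Finset.sum_add_distrib, Finset.sum_neg_distrib, hn v, Finset.sum_comm,
      Finset.sum_comm (f := fun ε i => if e' i = ε then (if G.src ε = v ∧ 0 < t' i then (1 : ℤ)
        else 0) else 0),
      Finset.sum_comm (f := fun ε i => if e' i = ε then (if G.tgt ε = v ∧ t' i = G.len ε
        then (1 : ℤ) else 0) else 0)]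
    simp only [Finset.sum_ite_eq, Finset.mem_univ, if_true]
    rw [neg_sub, sub_add_cancel, ← Finset.sum_sub_distrib, ← Finset.sum_add_distrib]
    refine Finset.sum_congr rfl fun i _ => ?_
    by_cases h1 : G.src (e' i) = v <;> by_cases h2 : 0 < t' i <;> simp [h1, h2]
  obtain ⟨v₀, hv₀, hmax⟩ := G.V.exists_max_image h G.V_nonempty
  have hzero : ∀ v, h v = h v₀ → ∀ ε, (G.src ε = v → a ε = 0) ∧ (G.tgt ε = v → b ε = 0) ∧
      ∀ i, (G.src (e' i) = v → 0 < t' i) ∧ (G.tgt (e' i) = v → t' i ≠ G.len (e' i)) := by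
    intro v hv
    have hle1 : ∀ ε, (if G.src ε = v then a ε else 0) ≤ 0 := by
      intro ε
      split_ifs with h1
      · exact ha_le ε (by rw [h1, hv]; exact hmax _ (G.tgt_mem ε))
      · exact le_rfl
    have hle2 : ∀ ε, (if G.tgt ε = v then b ε else 0) ≤ 0 := by
      intro ε
      split_ifs with h1
      · exact hb_le ε (by rw [h1, hv]; exact hmax _ (G.src_mem ε))
      · exact le_rfl
    have hge : ∀ i, (0 : ℤ) ≤ (if G.src (e' i) = v ∧ ¬0 < t' i then 1 else 0) +
        if G.tgt (e' i) = v ∧ t' i = G.len (e' i) then 1 else 0 := by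
      intro i
      positivity
    have hs := hsum v
    have hs1 := Finset.sum_nonpos fun ε (_ : ε ∈ Finset.univ) => add_nonpos (hle1 ε) (hle2 ε)
    have hs2 := Finset.sum_nonneg fun i (_ : i ∈ Finset.univ) => hge i
    have hs3 := (Finset.sum_eq_zero_iff_of_nonpos fun ε _ => add_nonpos (hle1 ε) (hle2 ε)).1
      (le_antisymm hs1 (hs ▸ hs2))
    have hs4 := (Finset.sum_eq_zero_iff_of_nonneg fun i _ => hge i).1
      (le_antisymm (hs ▸ hs1) hs2)
    intro ε
    have h3 := hs3 ε (Finset.mem_univ ε)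
    refine ⟨fun h1 => ?_, fun h1 => ?_, fun i => ⟨fun h1 => ?_, fun h1 h2 => ?_⟩⟩
    · have := hle2 ε
      have := hle1 ε
      rw [if_pos h1] at *
      omega
    · have := hle2 ε
      have := hle1 ε
      rw [if_pos h1] at *
      omega
    · have h4 := hs4 i (Finset.mem_univ i)
      by_contra h2
      rw [if_pos ⟨h1, h2⟩] at h4
      split_ifs at h4 <;> omega
    · have h4 := hs4 i (Finset.mem_univ i)
      rw [if_pos (show G.tgt (e' i) = v ∧ t' i = G.len (e' i) from ⟨h1, h2⟩)] at h4
      split_ifs at h4 <;> omega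
  -- the maximum locus is closed under the edges without a chip, hence contains all vertices
  have hconst : ∀ ε, h (G.src ε) = h v₀ ∧ h (G.tgt ε) = h v₀ := by
    have h1 : ∀ ε ∉ range e, (if h (G.src ε) = h v₀ then (1 : ℝ) else 0) =
        if h (G.tgt ε) = h v₀ then 1 else 0 := by
      intro ε hε
      have h2 := hh ε
      have h3 := hP ε
      have h3' := hQ ε
      have h4 := G.len_pos ε
      obtain ⟨-, hk, hT⟩ | ⟨i, hi, -⟩ := hchip ε
      swap
      · exact absurd ⟨i, hi⟩ hε
      rw [hT] at h2
      refine if_congr ⟨fun h5 => ?_, fun h5 => ?_⟩ rfl rfl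
      · have h6 := (hzero _ h5 ε).1 rfl
        simp only [ha, hk] at h6
        have h7 : (n ε : ℝ) = ((∑ i, if e' i = ε ∧ 0 < t' i then 1 else 0 : ℤ) : ℝ) :=
          congrArg _ (by omega)
        rw [← h7] at h3
        exact le_antisymm (hmax _ (G.tgt_mem ε)) (by linarith)
      · have h6 := (hzero _ h5 ε).2.1 rfl
        simp only [hb] at h6
        have h7 : (n ε : ℝ) = ((∑ i, if e' i = ε ∧ t' i = G.len ε then 1 else 0 : ℤ) : ℝ) :=
          congrArg _ (by omega)
        rw [← h7] at h3'
        exact le_antisymm (hmax _ (G.src_mem ε)) (by linarith)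
    have h2 := G.eq_of_linearIndependent he (h := fun v => if h v = h v₀ then (1 : ℝ) else 0) h1
    have h3 : ∀ v ∈ G.V, h v = h v₀ := by
      intro v hv
      have := G.eq_of_edges (h := fun v => if h v = h v₀ then (1 : ℝ) else 0) h2 hv hv₀
      by_contra hne
      simp [hne] at this
    exact fun ε => ⟨h3 _ (G.src_mem ε), h3 _ (G.tgt_mem ε)⟩
  have hpos : ∀ i, 0 < t' i := fun i => ((hzero _ (hconst (e' i)).1 (e' i)).2.2 i).1 rfl
  have hlt : ∀ i, t' i ≠ G.len (e' i) := fun i =>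
    ((hzero _ (hconst (e' i)).2 (e' i)).2.2 i).2 rfl
  have hfin : ∀ ε, (∑ i, if e i = ε then (1 : ℤ) else 0) = (∑ i, if e' i = ε then 1 else 0) ∧
      (∑ i, if e i = ε then t i else 0) = ∑ i, if e' i = ε then t' i else 0 := by
    intro ε
    have h1 := (hzero _ (hconst ε).1 ε).1 rfl
    have h2 := (hzero _ (hconst ε).2 ε).2.1 rfl
    simp only [ha, hpos, and_true] at h1
    have h3 : (∑ i, if e' i = ε ∧ t' i = G.len ε then (1 : ℤ) else 0) = 0 := by
      refine Finset.sum_eq_zero fun i _ => if_neg ?_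
      rintro ⟨rfl, h⟩
      exact hlt i h
    simp only [hb, h3] at h2
    have h4 : n ε = 0 := by omega
    have h5 := hh ε
    rw [(hconst ε).1, (hconst ε).2, h4] at h5
    refine ⟨by omega, ?_⟩
    push_cast at h5
    linarith
  refine Subtype.ext ?_
  have hgroup : ∀ (e : Fin d → G.E) (t : Fin d → ℝ),
      (∑ i, Finsupp.single (G.param (e i) (t i)) (1 : ℤ)) =
        ∑ ε, ∑ i with e i = ε, Finsupp.single (G.param ε (t i)) (1 : ℤ) := by
    intro e t
    rw [← Finset.sum_fiberwise Finset.univ e]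
    refine Finset.sum_congr rfl fun ε _ => Finset.sum_congr rfl fun i hi => ?_
    rw [(Finset.mem_filter.1 hi).2]
  change (∑ i, Finsupp.single (G.param (e i) (t i)) (1 : ℤ)) =
    ∑ i, Finsupp.single (G.param (e' i) (t' i)) (1 : ℤ)
  rw [hgroup e t, hgroup e' t']
  refine Finset.sum_congr rfl fun ε _ => ?_
  obtain ⟨h1, h2⟩ := hfin ε
  rw [← Finset.sum_filter, ← Finset.sum_filter] at h1 h2
  simp only [Finset.sum_const, mul_one, nsmul_eq_mul, Nat.cast_inj] at h1
  have hcard : (Finset.univ.filter fun i => e i = ε).card ≤ 1 := by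
    rw [Finset.card_le_one]
    intro i hi j hj
    exact hinj (((Finset.mem_filter.1 hi).2).trans (Finset.mem_filter.1 hj).2.symm)
  rcases Nat.le_one_iff_eq_zero_or_eq_one.1 hcard with h3 | h3
  · rw [Finset.card_eq_zero.1 h3, Finset.card_eq_zero.1 (h1.symm.trans h3)]
    simp
  · obtain ⟨i, hi⟩ := Finset.card_eq_one.1 h3
    obtain ⟨j, hj⟩ := Finset.card_eq_one.1 (h1.symm.trans h3)
    rw [hi, hj] at h2 ⊢
    simp only [Finset.sum_singleton] at h2 ⊢
    rw [h2]

end MetricGraph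

namespace MetricGraph

variable {Γ : Type*} [MetricSpace Γ] (G : MetricGraph Γ)

/-! ### Reduced divisors -/

open Classical in
/-- A function on the graph which is quadratic and strictly concave on all edges and whose
outgoing slopes at every vertex other than `q₀` add up to `0`. The sum over a divisor of its
values decreases when a set of chips is fired away from a closed set not containing `q₀`. -/
structure IsConcavePotential (q₀ : Γ) (u : Γ → ℝ) (α β : G.E → ℝ) : Prop where
  continuous : Continuous u
  apply_param : ∀ ε, ∀ t ∈ Icc 0 (G.len ε), u (G.param ε t) = α ε + β ε * t + t * (G.len ε - t) / 2
  kirchhoff : ∀ v, v ≠ q₀ → ∑ ε, (β ε * ((if G.src ε = v then 1 else 0) -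
    if G.tgt ε = v then 1 else 0) + G.len ε / 2 * ((if G.src ε = v then 1 else 0) +
    if G.tgt ε = v then 1 else 0)) = 0

theorem exists_isConcavePotential [ConnectedSpace Γ] {q₀ : Γ} (hq₀ : q₀ ∈ G.V) :
    ∃ u α β, G.IsConcavePotential q₀ u α β := by
  classical
  choose c hc using G.exists_isPathChain q₀
  set κ : Γ → ℝ := fun v => ∑ ε, G.len ε / 2 * ((if G.src ε = v then 1 else 0) +
    if G.tgt ε = v then 1 else 0) with hκ
  set C : G.E → ℝ := ∑ v ∈ G.V, κ v • c v with hC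
  have hβ : G.proj (C - (G.proj C : G.E → ℝ)) = 0 := by rw [map_sub, proj_coe, sub_self]
  set β : G.E → ℝ := C - (G.proj C : G.E → ℝ) with hβdef
  obtain ⟨h, hh⟩ := (G.proj_eq_zero_iff _).1 hβ
  obtain ⟨u, -, hu⟩ := G.exists_glue h
    (fun ε t => h (G.src ε) + β ε * t + t * (G.len ε - t) / 2) (fun ε => by simp) (fun ε => by
      have := hh ε
      simp only [sub_self, mul_zero, zero_div, add_zero]
      linarith)
  refine ⟨u, fun ε => h (G.src ε), β, ?_, hu, fun v hv => ?_⟩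
  · refine G.continuous_of_edges fun ε => ContinuousOn.congr (f := fun t =>
      h (G.src ε) + β ε * t + t * (G.len ε - t) / 2) ?_ (hu ε)
    fun_prop
  · have h1 : G.boundary β v = κ v := by
      rw [hβdef, map_sub, LinearMap.mem_ker.1 (G.proj C).2, sub_zero, hC, map_sum,
        Finsupp.finsetSum_apply]
      have h2 : ∀ w ∈ G.V, G.boundary (κ w • c w) v = if w = v then κ w else 0 := by
        intro w hw
        have h3 := (G.isPathChain_sub_integral hw hq₀ (hc w) IsPathChain.refl).2
        rw [sub_zero] at h3
        rw [map_smul, h3, Finsupp.smul_apply, Finsupp.sub_apply, Finsupp.single_apply,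
          Finsupp.single_apply, if_neg hv.symm]
        simp
      rw [Finset.sum_congr rfl h2, Finset.sum_ite_eq']
      by_cases hvV : v ∈ G.V
      · rw [if_pos hvV]
      · rw [if_neg hvV, hκ]
        refine (Finset.sum_eq_zero fun ε _ => ?_).symm
        have h3 : G.src ε ≠ v := fun h => hvV (h ▸ G.src_mem ε)
        have h4 : G.tgt ε ≠ v := fun h => hvV (h ▸ G.tgt_mem ε)
        simp [h3, h4]
    rw [boundary_apply] at h1
    rw [Finset.sum_add_distrib]
    have h2 : ∑ ε, β ε * ((if G.src ε = v then 1 else 0) - if G.tgt ε = v then 1 else 0) =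
        -κ v := by
      rw [← h1, ← Finset.sum_neg_distrib]
      refine Finset.sum_congr rfl fun ε _ => ?_
      ring
    rw [h2]
    exact neg_add_cancel _

/-- Some entries of a tuple can be replaced simultaneously. -/
theorem exists_move {X ι : Type*} {d : ℕ} (x : Fin d → X) (C : Finset ι) {i : ι → Fin d}
    (hi : InjOn i C) (y : ι → X) : ∃ x' : Fin d → X, ∀ {A : Type} [AddCommGroup A] (F : X → A),
      ∑ k, F (x' k) = ∑ k, F (x k) + ∑ c ∈ C, (F (y c) - F (x (i c))) := by
  classical
  refine ⟨fun k => if h : ∃ c ∈ C, i c = k then y h.choose else x k, fun F => ?_⟩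
  rw [← sub_eq_iff_eq_add', ← Finset.sum_sub_distrib,
    ← Finset.sum_subset (Finset.subset_univ (C.image i)), Finset.sum_image hi]
  · refine Finset.sum_congr rfl fun c hc => ?_
    have h : ∃ c' ∈ C, i c' = i c := ⟨c, hc, rfl⟩
    beta_reduce
    rw [dif_pos h, hi h.choose_spec.1 hc h.choose_spec.2]
  · intro k _ hk
    have h : ¬∃ c ∈ C, i c = k := by
      rintro ⟨c, hc, rfl⟩
      exact hk (Finset.mem_image_of_mem i hc)
    beta_reduce
    rw [dif_neg h, sub_self]

/-- No point of the tuple `x` lies in the interior of the edge `ε`. -/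
def IsEdgeFree {d : ℕ} (x : Fin d → Γ) (ε : G.E) : Prop :=
  ∀ i, x i ∉ G.param ε '' Ioo 0 (G.len ε)

open Classical in
/-- The edges with exactly one end in `U`. -/
noncomputable def cut (U : Finset Γ) : Finset G.E :=
  Finset.univ.filter fun ε => ¬(G.src ε ∈ U ↔ G.tgt ε ∈ U)

theorem mem_cut {U : Finset Γ} {ε : G.E} : ε ∈ G.cut U ↔ ¬(G.src ε ∈ U ↔ G.tgt ε ∈ U) := by
  simp [cut]

open Classical in
/-- The edges without chips which leave `U` at the vertex `v`. -/
noncomputable def freeCut {d : ℕ} (x : Fin d → Γ) (U : Finset Γ) (v : Γ) : Finset G.E :=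
  Finset.univ.filter fun ε => G.IsEdgeFree x ε ∧
    (G.src ε = v ∧ G.tgt ε ∉ U ∨ G.tgt ε = v ∧ G.src ε ∉ U)

open Classical in
/-- If no vertex of `U` burns when all other vertices do, distinct chips which can move away from
`U` can be chosen on the edges of the cut. -/
theorem exists_chips_on_cut {d : ℕ} {x : Fin d → Γ} {U : Finset Γ} (hU : U ⊆ G.V)
    (hne : (G.cut U).Nonempty) (hcard : ∀ v ∈ U,
      (G.freeCut x U v).card ≤ (Finset.univ.filter fun i => x i = v).card) :
    ∃ (i : G.E → Fin d) (τ : G.E → ℝ), InjOn i (G.cut U) ∧ ∀ ε ∈ G.cut U,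
      x (i ε) = G.param ε (τ ε) ∧ τ ε ∈ Icc 0 (G.len ε) ∧
      (G.src ε ∈ U → τ ε < G.len ε) ∧ (G.src ε ∉ U → 0 < τ ε) := by
  -- the end in `U` of an edge of the cut
  set w : G.E → Γ := fun ε => if G.src ε ∈ U then G.src ε else G.tgt ε with hw
  have hwU : ∀ ε ∈ G.cut U, w ε ∈ U := by
    intro ε hε
    rw [mem_cut] at hε
    simp only [hw]
    split_ifs with h
    · exact h
    · tauto
  have hwfree : ∀ ε ∈ G.cut U, G.IsEdgeFree x ε → ε ∈ G.freeCut x U (w ε) := by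
    intro ε hε hfree
    rw [mem_cut] at hε
    simp only [freeCut, Finset.mem_filter, Finset.mem_univ, true_and, hw]
    refine ⟨hfree, ?_⟩
    by_cases h : G.src ε ∈ U
    · exact Or.inl ⟨by rw [if_pos h], fun h' => hε ⟨fun _ => h', fun _ => h⟩⟩
    · exact Or.inr ⟨by rw [if_neg h], h⟩
  have hd : Nonempty (Fin d) := by
    obtain ⟨ε, hε⟩ := hne
    by_cases hfree : G.IsEdgeFree x ε
    · have h1 := (Finset.card_pos.2 ⟨ε, hwfree ε hε hfree⟩).trans_le (hcard _ (hwU ε hε))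
      obtain ⟨i, -⟩ := Finset.card_pos.1 h1
      exact ⟨i⟩
    · simp only [IsEdgeFree, not_forall] at hfree
      exact ⟨hfree.choose⟩
  have hinj : ∀ v, ∃ f : G.E → Fin d, v ∈ U → InjOn f (G.freeCut x U v) ∧
      ∀ ε ∈ G.freeCut x U v, x (f ε) = v := by
    intro v
    by_cases hv : v ∈ U
    · obtain ⟨f, hf, hf'⟩ := (G.freeCut x U v).finite_toSet.exists_injOn_of_encard_le
        (t := ((Finset.univ.filter fun i => x i = v : Finset (Fin d)) : Set (Fin d))) (by
          rw [Set.encard_coe_eq_coe_finsetCard, Set.encard_coe_eq_coe_finsetCard]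
          exact_mod_cast hcard v hv)
      exact ⟨f, fun _ => ⟨hf', fun ε hε => by simpa using hf hε⟩⟩
    · exact ⟨fun _ => hd.some, fun h => absurd h hv⟩
  choose f hf using hinj
  have hchip : ∀ ε, ∃ i : Fin d, ∃ τ, ε ∈ G.cut U → (x i = G.param ε τ ∧ τ ∈ Icc 0 (G.len ε) ∧
      (G.src ε ∈ U → τ < G.len ε) ∧ (G.src ε ∉ U → 0 < τ)) ∧
      (G.IsEdgeFree x ε → i = f (w ε) ε) ∧
      (¬G.IsEdgeFree x ε → x i ∈ G.param ε '' Ioo 0 (G.len ε)) := by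
    intro ε
    by_cases hfree : G.IsEdgeFree x ε
    · refine ⟨f (w ε) ε, if G.src ε ∈ U then 0 else G.len ε, fun hε =>
        ⟨?_, fun _ => rfl, fun h => absurd hfree h⟩⟩
      have h1 := (hf (w ε) (hwU ε hε)).2 ε (hwfree ε hε hfree)
      rw [h1]
      simp only [hw]
      split_ifs with h
      · exact ⟨rfl, G.zero_mem_Icc ε, fun _ => G.len_pos ε, fun h' => absurd h h'⟩
      · exact ⟨rfl, G.len_mem_Icc ε, fun h' => absurd h' h, fun _ => G.len_pos ε⟩
    · have h1 := hfree
      simp only [IsEdgeFree, not_forall, not_not] at h1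
      obtain ⟨i, τ, hτ, hi⟩ := h1
      exact ⟨i, τ, fun _ => ⟨⟨hi.symm, Ioo_subset_Icc_self hτ, fun _ => hτ.2, fun _ => hτ.1⟩,
        fun h => absurd h hfree, fun _ => ⟨τ, hτ, hi⟩⟩⟩
  choose i τ hiτ using hchip
  have hVfree : ∀ ε ∈ G.cut U, G.IsEdgeFree x ε → x (i ε) = w ε := by
    intro ε hε hfree
    rw [(hiτ ε hε).2.1 hfree]
    exact (hf (w ε) (hwU ε hε)).2 ε (hwfree ε hε hfree)
  have hopenV : ∀ ε, ∀ p ∈ G.param ε '' Ioo 0 (G.len ε), p ∉ U := by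
    rintro ε _ ⟨t, ht, rfl⟩ h
    exact G.param_notMem ε t ht (hU h)
  have hiinj : InjOn i (G.cut U) := by
    intro ε hε ε' hε' h
    by_cases h1 : G.IsEdgeFree x ε <;> by_cases h2 : G.IsEdgeFree x ε'
    · have h3 : w ε = w ε' := by rw [← hVfree ε hε h1, ← hVfree ε' hε' h2, h]
      rw [(hiτ ε hε).2.1 h1, (hiτ ε' hε').2.1 h2, ← h3] at h
      exact (hf (w ε) (hwU ε hε)).1 (hwfree ε hε h1) (h3 ▸ hwfree ε' hε' h2) h
    · have h3 := (hiτ ε' hε').2.2 h2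
      rw [← h, hVfree ε hε h1] at h3
      exact absurd (hwU ε hε) (hopenV _ _ h3)
    · have h3 := (hiτ ε hε).2.2 h1
      rw [h, hVfree ε' hε' h2] at h3
      exact absurd (hwU ε' hε') (hopenV _ _ h3)
    · obtain ⟨t, ht, h3⟩ := (hiτ ε hε).2.2 h1
      obtain ⟨t', ht', h4⟩ := (hiτ ε' hε').2.2 h2
      exact (G.param_inj ε ε' t ht t' ht' (by rw [h3, h4, h])).1
  exact ⟨i, τ, hiinj, fun ε hε => (hiτ ε hε).1⟩

variable [ConnectedSpace Γ]

/-- The tuple `x` minimizes the sum of the values of `u` among all tuples with the same image in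
the Jacobian. -/
def IsMinimizer (q : Γ) (u : Γ → ℝ) {d : ℕ} (x : Fin d → Γ) : Prop :=
  ∀ x' : Fin d → Γ, ∑ i, G.pointToJac q (x' i) = ∑ i, G.pointToJac q (x i) →
    ∑ i, u (x i) ≤ ∑ i, u (x' i)

theorem IsMinimizer.sum_nonneg {G : MetricGraph Γ} {q : Γ} {u : Γ → ℝ} {d : ℕ} {x : Fin d → Γ}
    (hx : G.IsMinimizer q u x) {ι : Type*} {C : Finset ι} {i : ι → Fin d} (hi : InjOn i C)
    {y : ι → Γ} (hy : ∑ c ∈ C, (G.pointToJac q (y c) - G.pointToJac q (x (i c))) = 0) :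
    0 ≤ ∑ c ∈ C, (u (y c) - u (x (i c))) := by
  obtain ⟨x', hx'⟩ := exists_move x C hi y
  have h := hx x' (by rw [hx', hy, add_zero])
  rw [hx'] at h
  linarith

/-- A minimizer has at most one chip in the interior of each edge, as two chips could move
apart. -/
theorem IsMinimizer.eq_of_mem_Ioo {G : MetricGraph Γ} {q q₀ : Γ} {u : Γ → ℝ} {α β : G.E → ℝ}
    (hu : G.IsConcavePotential q₀ u α β) {d : ℕ} {x : Fin d → Γ} (hx : G.IsMinimizer q u x)
    {ε : G.E} {i j : Fin d} {s t : ℝ} (hs : s ∈ Ioo 0 (G.len ε)) (ht : t ∈ Ioo 0 (G.len ε))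
    (hi : x i = G.param ε s) (hj : x j = G.param ε t) : i = j := by
  wlog hst : s ≤ t generalizing i j s t
  · exact (this ht hs hj hi (le_of_not_ge hst)).symm
  by_contra hij
  obtain ⟨δ, hδ, hδs, hδt⟩ : ∃ δ > 0, δ ≤ s ∧ δ ≤ G.len ε - t :=
    ⟨min s (G.len ε - t), lt_min hs.1 (sub_pos.2 ht.2), min_le_left _ _, min_le_right _ _⟩
  have hs' : s - δ ∈ Icc 0 (G.len ε) := ⟨by linarith, by linarith [hs.2]⟩
  have ht' : t + δ ∈ Icc 0 (G.len ε) := ⟨by linarith [ht.1], by linarith⟩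
  have h := hx.sum_nonneg (C := Finset.univ) (i := fun b : Bool => if b then i else j)
    (y := fun b : Bool => if b then G.param ε (s - δ) else G.param ε (t + δ)) (by
      intro a _ b _ h
      cases a <;> cases b <;> simp_all [eq_comm]) (by
      have hs'' := Ioo_subset_Icc_self hs
      have ht'' := Ioo_subset_Icc_self ht
      simp only [Fintype.sum_bool, if_true, Bool.false_eq_true, if_false, hi, hj]
      rw [G.pointToJac_param q ε hs', G.pointToJac_param q ε ht', G.pointToJac_param q ε hs'',
        G.pointToJac_param q ε ht'', ← QuotientAddGroup.mk_sub, ← QuotientAddGroup.mk_sub,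
        ← QuotientAddGroup.mk_add]
      convert QuotientAddGroup.mk_zero (G.H1Int) using 2
      module)
  simp only [Fintype.sum_bool, if_true, Bool.false_eq_true, if_false, hi, hj] at h
  rw [hu.apply_param _ _ hs', hu.apply_param _ _ ht',
    hu.apply_param _ _ (Ioo_subset_Icc_self hs), hu.apply_param _ _ (Ioo_subset_Icc_self ht)] at h
  nlinarith

theorem cut_nonempty {U : Finset Γ} {q₀ : Γ} (hq₀ : q₀ ∈ G.V) (hU : U ⊆ G.V) (hne : U.Nonempty)
    (hqU : q₀ ∉ U) : (G.cut U).Nonempty := by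
  by_contra hemp
  rw [Finset.not_nonempty_iff_eq_empty, Finset.eq_empty_iff_forall_notMem] at hemp
  have h1 : ∀ ε, (G.src ε ∈ U) = (G.tgt ε ∈ U) := fun ε =>
    propext (not_not.1 (G.mem_cut.not.1 (hemp ε)))
  obtain ⟨v, hv⟩ := hne
  exact hqU ((G.eq_of_edges (h := fun v => v ∈ U) h1 (hU hv) hq₀).mp hv)

open Classical in
/-- Dhar's burning criterion for a minimizer: otherwise, on each edge leaving `U` there would be a
chip that could move away from `U`. -/
theorem IsMinimizer.exists_lt_card_freeCut {G : MetricGraph Γ} {q q₀ : Γ} {u : Γ → ℝ}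
    {α β : G.E → ℝ} (hq₀ : q₀ ∈ G.V) (hu : G.IsConcavePotential q₀ u α β) {d : ℕ} {x : Fin d → Γ}
    (hx : G.IsMinimizer q u x) {U : Finset Γ} (hU : U ⊆ G.V) (hne : U.Nonempty) (hqU : q₀ ∉ U) :
    ∃ v ∈ U, (Finset.univ.filter fun i => x i = v).card < (G.freeCut x U v).card := by
  by_contra! hcard
  obtain ⟨i, τ, hiinj, hiτ⟩ :=
    G.exists_chips_on_cut hU (G.cut_nonempty hq₀ hU hne hqU) hcard
  set σ : G.E → ℝ := fun ε => (if G.src ε ∈ U then 1 else 0) - if G.tgt ε ∈ U then 1 else 0 with hσ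
  have hσ1 : ∀ ε ∈ G.cut U, (G.src ε ∈ U ∧ G.tgt ε ∉ U ∧ σ ε = 1) ∨
      (G.src ε ∉ U ∧ G.tgt ε ∈ U ∧ σ ε = -1) := by
    intro ε hε
    rw [mem_cut] at hε
    simp only [hσ]
    by_cases h1 : G.src ε ∈ U <;> by_cases h2 : G.tgt ε ∈ U
    · exact absurd ⟨fun _ => h2, fun _ => h1⟩ hε
    · exact Or.inl ⟨h1, h2, by rw [if_pos h1, if_neg h2, sub_zero]⟩
    · exact Or.inr ⟨h1, h2, by rw [if_neg h1, if_pos h2, zero_sub]⟩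
    · exact absurd ⟨fun h => absurd h h1, fun h => absurd h h2⟩ hε
  have hδ : ∀ᶠ δ in 𝓝[>] (0 : ℝ), ∀ ε, ε ∈ G.cut U → τ ε + σ ε * δ ∈ Icc 0 (G.len ε) := by
    rw [Filter.eventually_all]
    intro ε
    by_cases hε : ε ∈ G.cut U
    · obtain ⟨-, hτ, hτ1, hτ2⟩ := hiτ ε hε
      rcases hσ1 ε hε with ⟨h1, h2, h3⟩ | ⟨h1, h2, h3⟩
      · filter_upwards [Ioo_mem_nhdsGT (sub_pos.2 (hτ1 h1))] with δ hδ _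
        rw [h3]
        exact ⟨by linarith [hτ.1, hδ.1], by linarith [hδ.2]⟩
      · filter_upwards [Ioo_mem_nhdsGT (hτ2 h1)] with δ hδ _
        rw [h3]
        exact ⟨by linarith [hδ.2], by linarith [hδ.1, hτ.2]⟩
    · exact Filter.Eventually.of_forall fun _ h => absurd h hε
  obtain ⟨δ, hδmem, hδpos⟩ := (hδ.and self_mem_nhdsWithin).exists
  replace hδpos : 0 < δ := hδpos
  -- the move does not change the image in the Jacobian, as the cut is orthogonal to all cycles
  have hcut : ∑ ε ∈ G.cut U, ((σ ε * δ) / G.len ε) • G.edgeClass ε = 0 := by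
    rw [Finset.sum_subset (Finset.subset_univ (G.cut U)),
      ← G.proj_eq_sum fun ε => (σ ε * δ) / G.len ε, proj_eq_zero_iff]
    · refine ⟨fun v => if v ∈ U then -δ else 0, fun ε => ?_⟩
      rw [mul_div_cancel₀ _ (G.len_pos ε).ne']
      simp only [hσ]
      split_ifs <;> ring
    · intro ε _ hε
      rw [mem_cut, not_not] at hε
      have : σ ε = 0 := by simp [hσ, hε]
      rw [this, zero_mul, zero_div, zero_smul]
  have h0 := hx.sum_nonneg hiinj (y := fun ε => G.param ε (τ ε + σ ε * δ)) (by
    have h1 : ∀ ε ∈ G.cut U, G.pointToJac q (G.param ε (τ ε + σ ε * δ)) - G.pointToJac q (x (i ε)) =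
        QuotientAddGroup.mk' G.H1Int (((σ ε * δ) / G.len ε) • G.edgeClass ε) := by
      intro ε hε
      rw [(hiτ ε hε).1, G.pointToJac_param q ε (hδmem ε hε),
        G.pointToJac_param q ε (hiτ ε hε).2.1, ← QuotientAddGroup.mk_sub,
        QuotientAddGroup.mk'_apply]
      congr 1
      module
    rw [Finset.sum_congr rfl h1, ← map_sum, hcut, map_zero])
  have h1 : ∀ ε ∈ G.cut U, u (G.param ε (τ ε + σ ε * δ)) - u (x (i ε)) ≤
      δ * (σ ε * β ε + ((if G.src ε ∈ U then 1 else 0) + if G.tgt ε ∈ U then 1 else 0) *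
        (G.len ε / 2)) - δ ^ 2 / 2 := by
    intro ε hε
    obtain ⟨h2, h3, -⟩ := hiτ ε hε
    rw [h2, hu.apply_param ε _ (hδmem ε hε), hu.apply_param ε _ h3]
    rcases hσ1 ε hε with ⟨h4, h5, h6⟩ | ⟨h4, h5, h6⟩
    · rw [h6, if_pos h4, if_neg h5]
      nlinarith [mul_nonneg hδpos.le h3.1]
    · rw [h6, if_neg h4, if_pos h5]
      nlinarith [mul_nonneg hδpos.le (sub_nonneg.2 h3.2)]
  have h2 : ∑ ε ∈ G.cut U, (σ ε * β ε + ((if G.src ε ∈ U then 1 else 0) +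
      if G.tgt ε ∈ U then 1 else 0) * (G.len ε / 2)) ≤ 0 := by
    have h3 : ∑ v ∈ U, ∑ ε, (β ε * ((if G.src ε = v then 1 else 0) -
        if G.tgt ε = v then 1 else 0) + G.len ε / 2 * ((if G.src ε = v then 1 else 0) +
        if G.tgt ε = v then 1 else 0)) = 0 :=
      Finset.sum_eq_zero fun v hv => hu.kirchhoff v fun h => hqU (h ▸ hv)
    rw [Finset.sum_comm] at h3
    refine le_of_le_of_eq ?_ h3
    have h4 : ∀ ε, ∑ v ∈ U, (β ε * ((if G.src ε = v then 1 else 0) -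
        if G.tgt ε = v then 1 else 0) + G.len ε / 2 * ((if G.src ε = v then 1 else 0) +
        if G.tgt ε = v then 1 else 0)) = σ ε * β ε + ((if G.src ε ∈ U then 1 else 0) +
        if G.tgt ε ∈ U then 1 else 0) * (G.len ε / 2) := by
      intro ε
      rw [Finset.sum_add_distrib, ← Finset.mul_sum, ← Finset.mul_sum, Finset.sum_sub_distrib,
        Finset.sum_add_distrib, Finset.sum_ite_eq, Finset.sum_ite_eq, hσ]
      ring
    rw [Finset.sum_congr rfl fun ε _ => h4 ε]
    refine Finset.sum_le_sum_of_subset_of_nonneg (Finset.subset_univ (G.cut U)) fun ε _ hε => ?_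
    rw [mem_cut, not_not] at hε
    have h5 : σ ε = 0 := by simp [hσ, hε]
    rw [h5, zero_mul, zero_add]
    refine mul_nonneg ?_ (half_pos (G.len_pos ε)).le
    split_ifs <;> norm_num
  have h3 := Finset.sum_le_sum h1
  rw [Finset.sum_sub_distrib (f := fun ε => δ * _), ← Finset.mul_sum, Finset.sum_const,
    nsmul_eq_mul] at h3
  have h4 : (0 : ℝ) < (G.cut U).card * (δ ^ 2 / 2) := by
    have : (0 : ℝ) < (G.cut U).card := by exact_mod_cast (G.cut_nonempty hq₀ hU hne hqU).card_pos
    positivity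
  nlinarith

open Classical in
/-- Burning the vertices of `U` one after the other, all but one of the burning edges at a vertex
can be deleted without disconnecting it; by the criterion, there are at least as many of these as
chips at the vertex. -/
theorem IsMinimizer.exists_selection {G : MetricGraph Γ} {q q₀ : Γ} {u : Γ → ℝ}
    {α β : G.E → ℝ} (hq₀ : q₀ ∈ G.V) (hu : G.IsConcavePotential q₀ u α β) {d : ℕ} {x : Fin d → Γ}
    (hx : G.IsMinimizer q u x) {U : Finset Γ} (hU : U ⊆ G.V) (hqU : q₀ ∉ U) :
    ∃ S : Finset G.E, S.card = ∑ v ∈ U, (Finset.univ.filter fun i => x i = v).card ∧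
      (∀ ε ∈ S, G.IsEdgeFree x ε ∧ (G.src ε ∈ U ∨ G.tgt ε ∈ U) ∧
        ∃ i, x i = G.src ε ∨ x i = G.tgt ε) ∧
      ∀ (h : Γ → ℝ) (c : ℝ), (∀ v ∈ G.V, v ∉ U → h v = c) →
        (∀ ε, G.IsEdgeFree x ε → ε ∉ S → h (G.src ε) = h (G.tgt ε)) → ∀ v ∈ U, h v = c := by
  induction U using Finset.strongInduction with
  | H U ih =>
  rcases U.eq_empty_or_nonempty with rfl | hne
  · exact ⟨∅, by simp, by simp, by simp⟩
  obtain ⟨v, hv, hcard⟩ := hx.exists_lt_card_freeCut hq₀ hu hU hne hqU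
  obtain ⟨S, hS1, hS2, hS3⟩ := ih (U.erase v) (Finset.erase_ssubset hv)
    ((Finset.erase_subset v U).trans hU) (fun h => hqU (Finset.mem_of_mem_erase h))
  obtain ⟨R, hRsub, hRcard⟩ := Finset.exists_subset_card_eq hcard.le
  have hfree : ∀ ε ∈ G.freeCut x U v, G.IsEdgeFree x ε ∧
      (G.src ε = v ∧ G.tgt ε ∉ U ∨ G.tgt ε = v ∧ G.src ε ∉ U) := by
    intro ε hε
    simpa [freeCut] using hε
  have hdisj : ∀ ε ∈ G.freeCut x U v, ε ∉ S := by
    intro ε hε hεS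
    have h1 := (hS2 ε hεS).2.1
    simp only [Finset.mem_erase] at h1
    rcases (hfree ε hε).2 with ⟨h2, h3⟩ | ⟨h2, h3⟩ <;> tauto
  refine ⟨S ∪ R, ?_, ?_, ?_⟩
  · rw [Finset.card_union_of_disjoint, hS1, hRcard, Finset.sum_erase_add _ _ hv]
    rw [Finset.disjoint_left]
    exact fun ε hε hεR => hdisj ε (hRsub hεR) hε
  · intro ε hε
    rcases Finset.mem_union.1 hε with h1 | h1
    · obtain ⟨h2, h3, h4⟩ := hS2 ε h1
      exact ⟨h2, h3.imp Finset.mem_of_mem_erase Finset.mem_of_mem_erase, h4⟩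
    · obtain ⟨h2, h3⟩ := hfree ε (hRsub h1)
      have h4 : 0 < (Finset.univ.filter fun i => x i = v).card := by
        rw [← hRcard]
        exact Finset.card_pos.2 ⟨ε, h1⟩
      obtain ⟨i, hi⟩ := Finset.card_pos.1 h4
      rw [Finset.mem_filter] at hi
      refine ⟨h2, ?_, i, ?_⟩
      · rcases h3 with ⟨h3, -⟩ | ⟨h3, -⟩
        · exact Or.inl (h3 ▸ hv)
        · exact Or.inr (h3 ▸ hv)
      · rcases h3 with ⟨h3, -⟩ | ⟨h3, -⟩
        · exact Or.inl (hi.2.trans h3.symm)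
        · exact Or.inr (hi.2.trans h3.symm)
  · intro h c hc hε
    -- the edge along which `v` burns
    obtain ⟨ε, hεcut, hεR⟩ := Finset.exists_mem_notMem_of_card_lt_card (hRcard ▸ hcard)
    have hvc : h v = c := by
      obtain ⟨h2, h3⟩ := hfree ε hεcut
      have h4 := hε ε h2 fun h5 => (Finset.mem_union.1 h5).elim (hdisj ε hεcut) hεR
      rcases h3 with ⟨h3, h5⟩ | ⟨h3, h5⟩
      · rw [← h3, h4, hc _ (G.tgt_mem ε) h5]
      · rw [← h3, ← h4, hc _ (G.src_mem ε) h5]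
    have h1 := hS3 h c (fun w hw hwU => by
      by_cases hwv : w = v
      · rw [hwv, hvc]
      · exact hc w hw fun h2 => hwU (Finset.mem_erase.2 ⟨hwv, h2⟩))
    intro w hw
    by_cases hwv : w = v
    · rw [hwv, hvc]
    · refine h1 (fun ε' hε' hεS' => ?_) w (Finset.mem_erase.2 ⟨hwv, hw⟩)
      by_cases h2 : ε' ∈ R
      · obtain ⟨-, ⟨h3, h4⟩ | ⟨h3, h4⟩⟩ := hfree ε' (hRsub h2)
        · rw [h3, hvc, hc _ (G.tgt_mem ε') h4]
        · rw [h3, hvc, hc _ (G.src_mem ε') h4]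
      · exact hε ε' hε' fun h3 => (Finset.mem_union.1 h3).elim hεS' h2

open Classical in
/-- A minimizer without chip at `q₀` touches `d` edges with independent classes. -/
theorem IsMinimizer.exists_independent {G : MetricGraph Γ} {q q₀ : Γ} {u : Γ → ℝ}
    {α β : G.E → ℝ} (hq₀ : q₀ ∈ G.V) (hu : G.IsConcavePotential q₀ u α β) {d : ℕ} {x : Fin d → Γ}
    (hx : G.IsMinimizer q u x) (hxq : ∀ i, x i ≠ q₀) :
    ∃ S : Finset G.E, d ≤ S.card ∧ LinearIndependent ℝ (fun ε : S => G.edgeClass ε) ∧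
      ∀ ε ∈ S, ∃ i, x i ∈ G.param ε '' Icc 0 (G.len ε) := by
  obtain ⟨S, hS1, hS2, hS3⟩ := hx.exists_selection hq₀ hu (Finset.erase_subset q₀ G.V)
    (Finset.notMem_erase q₀ G.V)
  set R : Finset G.E := Finset.univ.filter fun ε => ¬G.IsEdgeFree x ε with hR
  refine ⟨S ∪ R, ?_, ?_, ?_⟩
  · rw [Finset.card_union_of_disjoint]
    · have h1 : (Finset.univ.filter fun i => x i ∈ G.V).card = S.card := by
        rw [hS1, Finset.card_eq_sum_card_fiberwise (f := x) (t := G.V.erase q₀)]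
        · refine Finset.sum_congr rfl fun v hv => ?_
          congr 1
          ext i
          simp only [Finset.mem_filter, Finset.mem_univ, true_and, and_iff_right_iff_imp]
          rintro rfl
          exact Finset.mem_of_mem_erase hv
        · intro i hi
          exact Finset.mem_coe.2 (Finset.mem_erase.2
            ⟨hxq i, (Finset.mem_filter.1 (Finset.mem_coe.1 hi)).2⟩)
      have h2 : (Finset.univ.filter fun i => x i ∉ G.V).card ≤ R.card := by
        refine Finset.card_le_card_of_forall_subsingleton
          (fun i ε => x i ∈ G.param ε '' Ioo 0 (G.len ε)) (fun i hi => ?_) fun ε _ i hi j hj => ?_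
        · obtain ⟨ε, h4⟩ := (G.mem_V_or_openEdge (x i)).resolve_left (Finset.mem_filter.1 hi).2
          exact ⟨ε, Finset.mem_filter.2 ⟨Finset.mem_univ _, fun h => h i h4⟩, h4⟩
        · obtain ⟨s, hs, hs'⟩ := hi.2
          obtain ⟨t, ht, ht'⟩ := hj.2
          exact hx.eq_of_mem_Ioo hu hs ht hs'.symm ht'.symm
      have h3 := Finset.card_filter_add_card_filter_not (s := (Finset.univ : Finset (Fin d)))
        (fun i => x i ∈ G.V)
      rw [Finset.card_univ, Fintype.card_fin] at h3
      omega
    · rw [Finset.disjoint_left]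
      exact fun ε hε hεR => (Finset.mem_filter.1 hεR).2 (hS2 ε hε).1
  · refine G.linearIndependent_of_forall (e := fun ε : ((S ∪ R : Finset G.E) : Type) => (ε : G.E))
      Subtype.val_injective fun h hh => ?_
    have h1 : ∀ v ∈ G.V, h v = h q₀ := by
      intro v hv
      by_cases hvq : v = q₀
      · rw [hvq]
      · refine hS3 h (h q₀) (fun w hw hwU => ?_) (fun ε hε hεS => hh ε ?_) v
          (Finset.mem_erase.2 ⟨hvq, hv⟩)
        · by_contra hne
          exact hwU (Finset.mem_erase.2 ⟨fun h => hne (by rw [h]), hw⟩)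
        · rw [Subtype.range_coe_subtype]
          intro h2
          rcases Finset.mem_union.1 h2 with h3 | h3
          · exact hεS h3
          · exact (Finset.mem_filter.1 h3).2 hε
    intro ε
    rw [h1 _ (G.src_mem ε), h1 _ (G.tgt_mem ε)]
  · intro ε hε
    rcases Finset.mem_union.1 hε with h1 | h1
    · obtain ⟨-, -, i, hi⟩ := hS2 ε h1
      refine ⟨i, ?_⟩
      rcases hi with hi | hi
      · exact ⟨0, G.zero_mem_Icc ε, hi.symm⟩
      · exact ⟨G.len ε, G.len_mem_Icc ε, hi.symm⟩
    · have h2 := (Finset.mem_filter.1 h1).2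
      simp only [IsEdgeFree, not_forall, not_not] at h2
      obtain ⟨i, hi⟩ := h2
      exact ⟨i, image_mono Ioo_subset_Icc_self hi⟩

end MetricGraph

namespace MetricGraph

variable {Γ : Type*} [MetricSpace Γ] (G : MetricGraph Γ)

/-! ### Cells of the symmetric powers -/

/-- The parameters of the tuples of points on the tuple of closed edges `e`. -/
def box {d : ℕ} (e : Fin d → G.E) : Set (Fin d → ℝ) := Set.pi univ fun i => Icc 0 (G.len (e i))

/-- The parameters of the tuples of points on the tuple of open edges `e`. -/
def openBox {d : ℕ} (e : Fin d → G.E) : Set (Fin d → ℝ) :=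
  Set.pi univ fun i => Ioo 0 (G.len (e i))

theorem isOpen_openBox {d : ℕ} (e : Fin d → G.E) : IsOpen (G.openBox e) :=
  isOpen_set_pi finite_univ fun _ _ => isOpen_Ioo

theorem closure_openBox {d : ℕ} (e : Fin d → G.E) : closure (G.openBox e) = G.box e := by
  rw [openBox, closure_pi_set]
  exact Set.pi_congr rfl fun i _ => closure_Ioo (G.len_pos _).ne

theorem openBox_subset_box {d : ℕ} (e : Fin d → G.E) : G.openBox e ⊆ G.box e :=
  Set.pi_mono fun _ _ => Ioo_subset_Icc_self

/-- The linear part of the Abel–Jacobi map on the cell of a tuple of edges. -/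
noncomputable def cellLin {d : ℕ} (e : Fin d → G.E) : (Fin d → ℝ) →ₗ[ℝ] G.H1 :=
  Fintype.linearCombination ℝ fun i => (1 / G.len (e i)) • G.edgeClass (e i)

theorem cellLin_apply {d : ℕ} (e : Fin d → G.E) (t : Fin d → ℝ) :
    G.cellLin e t = ∑ i, (t i / G.len (e i)) • G.edgeClass (e i) := by
  simp only [cellLin, Fintype.linearCombination_apply, smul_smul, mul_one_div]

/-- The direction of the image of the cell of a tuple of edges. -/
noncomputable def cellSpan {d : ℕ} (e : Fin d → G.E) : Submodule ℝ G.H1 :=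
  Submodule.span ℝ (range fun i => G.edgeClass (e i))

theorem edgeClass_mem_cellSpan {d : ℕ} (e : Fin d → G.E) (i : Fin d) :
    G.edgeClass (e i) ∈ G.cellSpan e := Submodule.subset_span ⟨i, rfl⟩

theorem cellLin_mem {d : ℕ} (e : Fin d → G.E) (t : Fin d → ℝ) : G.cellLin e t ∈ G.cellSpan e := by
  rw [cellLin_apply]
  exact Submodule.sum_mem _ fun i _ => Submodule.smul_mem _ _ (G.edgeClass_mem_cellSpan e i)

theorem cellLin_single {d : ℕ} (e : Fin d → G.E) (i : Fin d) :
    G.cellLin e (Pi.single i (G.len (e i))) = G.edgeClass (e i) := by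
  rw [cellLin, Fintype.linearCombination_apply_single, smul_smul,
    mul_one_div_cancel (G.len_pos _).ne', one_smul]

theorem cellLin_injective {d : ℕ} {e : Fin d → G.E}
    (he : LinearIndependent ℝ fun i => G.edgeClass (e i)) : Function.Injective (G.cellLin e) := by
  rw [injective_iff_map_eq_zero]
  intro t ht
  rw [cellLin_apply] at ht
  ext i
  exact (div_eq_zero_iff.1 (Fintype.linearIndependent_iff.1 he _ ht i)).resolve_right
    (G.len_pos _).ne'

theorem linearIndependent_of_finrank {d : ℕ} {e : Fin d → G.E}
    (h : d ≤ Module.finrank ℝ (G.cellSpan e)) :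
    LinearIndependent ℝ fun i => G.edgeClass (e i) := by
  rw [linearIndependent_iff_card_le_finrank_span, Fintype.card_fin]
  exact h

theorem span_edgeClass : Submodule.span ℝ (range G.edgeClass) = ⊤ := by
  refine eq_top_iff.2 fun z _ => ?_
  rw [← G.proj_coe z, proj_eq_sum]
  exact Submodule.sum_mem _ fun ε _ => Submodule.smul_mem _ _ (Submodule.subset_span ⟨ε, rfl⟩)

variable [ConnectedSpace Γ]

/-- A lift to `H₁(Γ, ℝ)` of the Abel–Jacobi map on the cell of a tuple of edges. -/
noncomputable def cellMap (q : Γ) {d : ℕ} (e : Fin d → G.E) : (Fin d → ℝ) →ᵃ[ℝ] G.H1 :=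
  (G.cellLin e).toAffineMap + AffineMap.const ℝ (Fin d → ℝ) (∑ i, G.baseLift q (e i))

theorem cellMap_apply (q : Γ) {d : ℕ} (e : Fin d → G.E) (t : Fin d → ℝ) :
    G.cellMap q e t = G.cellLin e t + ∑ i, G.baseLift q (e i) := rfl

theorem continuous_cellMap (q : Γ) {d : ℕ} (e : Fin d → G.E) : Continuous (G.cellMap q e) :=
  (G.cellMap q e).continuous_of_finiteDimensional

theorem mk_cellMap (q : Γ) {d : ℕ} (e : Fin d → G.E) {t : Fin d → ℝ} (ht : t ∈ G.box e) :
    (QuotientAddGroup.mk (G.cellMap q e t) : G.Jac) =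
      ∑ i, G.pointToJac q (G.param (e i) (t i)) := by
  rw [cellMap_apply, cellLin_apply, ← Finset.sum_add_distrib, ← QuotientAddGroup.mk'_apply, map_sum]
  refine Finset.sum_congr rfl fun i _ => ?_
  rw [G.pointToJac_param q (e i) (ht i (mem_univ i)), QuotientAddGroup.mk'_apply, add_comm]

/-- At a general point, a cell meets only those cells whose direction contains its own. -/
theorem exists_generic {q : Γ} {d : ℕ} {e : Fin d → G.E} {t₀ : Fin d → ℝ} (ht₀ : t₀ ∈ G.box e)
    {O : Set G.Jac} (hO : IsOpen O) (h₀ : QuotientAddGroup.mk (G.cellMap q e t₀) ∈ O) :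
    ∃ t ∈ G.openBox e, QuotientAddGroup.mk (G.cellMap q e t) ∈ O ∧
      ∀ (e' : Fin d → G.E) (t' : Fin d → ℝ), (QuotientAddGroup.mk (G.cellMap q e' t') : G.Jac) =
        QuotientAddGroup.mk (G.cellMap q e t) → G.cellSpan e ≤ G.cellSpan e' := by
  have := G.countable_H1Int
  set N : Set (Fin d → ℝ) := (fun t => QuotientAddGroup.mk (G.cellMap q e t)) ⁻¹' O with hN
  have hNo : IsOpen N :=
    hO.preimage (QuotientAddGroup.continuous_mk.comp (G.continuous_cellMap q e))
  have hne : (N ∩ G.openBox e).Nonempty := by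
    rw [← G.closure_openBox] at ht₀
    exact mem_closure_iff.1 ht₀ N hNo h₀
  -- the parameters of points which a lattice translate of the affine span of the cell of `e'` meets
  set Z : (Fin d → G.E) × G.H1Int → AffineSubspace ℝ (Fin d → ℝ) := fun p =>
    (AffineSubspace.mk' (G.cellMap q p.1 0 + p.2) (G.cellSpan p.1)).comap (G.cellMap q e) with hZ
  have hmemZ : ∀ p t, t ∈ Z p ↔ G.cellMap q e t - (G.cellMap q p.1 0 + p.2) ∈ G.cellSpan p.1 := by
    intro p t
    rw [hZ, AffineSubspace.mem_comap, AffineSubspace.mem_mk', vsub_eq_sub]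
  set B : Set (Fin d → ℝ) := ⋃ p ∈ {p : (Fin d → G.E) × G.H1Int | ¬G.cellSpan e ≤ G.cellSpan p.1},
    (Z p : Set (Fin d → ℝ)) with hB
  have hBnull : MeasureTheory.volume B = 0 := by
    rw [hB, MeasureTheory.measure_biUnion_null_iff (Set.to_countable _)]
    intro p hp
    refine MeasureTheory.Measure.addHaar_affineSubspace _ _ fun htop => hp ?_
    refine Submodule.span_le.2 ?_
    rintro _ ⟨i, rfl⟩
    have h1 : ∀ t, G.cellMap q e t - (G.cellMap q p.1 0 + p.2) ∈ G.cellSpan p.1 := by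
      intro t
      rw [← hmemZ, htop]
      exact AffineSubspace.mem_top ℝ _ t
    have h2 := Submodule.sub_mem _ (h1 (Pi.single i (G.len (e i)))) (h1 0)
    rw [sub_sub_sub_cancel_right, cellMap_apply, cellMap_apply, add_sub_add_right_eq_sub, map_zero,
      sub_zero, cellLin_single] at h2
    exact h2
  obtain ⟨t, htN, htB⟩ : ((N ∩ G.openBox e) \ B).Nonempty := by
    by_contra hemp
    rw [Set.not_nonempty_iff_eq_empty, Set.sdiff_eq_empty] at hemp
    exact ((hNo.inter (G.isOpen_openBox e)).measure_pos MeasureTheory.volume hne).ne'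
      (MeasureTheory.measure_mono_null hemp hBnull)
  refine ⟨t, htN.2, htN.1, fun e' t' h => ?_⟩
  by_contra hle
  rw [QuotientAddGroup.eq] at h
  refine htB (mem_biUnion (show (e', ⟨_, h⟩) ∈ {p : (Fin d → G.E) × G.H1Int |
    ¬G.cellSpan e ≤ G.cellSpan p.1} from hle) ?_)
  refine (hmemZ _ _).2 ?_
  have h1 : G.cellMap q e t - (G.cellMap q e' 0 + (-G.cellMap q e' t' + G.cellMap q e t)) =
      G.cellLin e' t' := by
    rw [cellMap_apply _ _ e', cellMap_apply _ _ e', map_zero]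
    abel
  exact h1 ▸ G.cellLin_mem e' t'

/-- Effective divisors of degree `d` supported in the interiors of independent edges are dense in
the image of the Abel–Jacobi map. At a general point of the image, all edges touched by a divisor
over it have classes in the direction `L` of the image. If the dimension of `L` were less than
`d ≤ g`, there would be a vertex `q₀` touched by no such divisor. But then a minimizer with respect
to `q₀` would touch `d` independent edges. -/
theorem exists_independent_mem [CompactSpace Γ] {q : Γ} {d : ℕ} (hd : d ≤ G.genus)
    (x₀ : Fin d → Γ) {O : Set G.Jac} (hO : IsOpen O) (hx₀ : ∑ i, G.pointToJac q (x₀ i) ∈ O) :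
    ∃ e : Fin d → G.E, (LinearIndependent ℝ fun i => G.edgeClass (e i)) ∧
      ∃ t ∈ G.openBox e, QuotientAddGroup.mk (G.cellMap q e t) ∈ O := by
  classical
  rcases Nat.eq_zero_or_pos d with rfl | hdpos
  · refine ⟨Fin.elim0, linearIndependent_empty_type, 0, fun i => i.elim0, ?_⟩
    rw [G.mk_cellMap q _ (fun i => i.elim0)]
    simpa using hx₀
  obtain ⟨ε₀⟩ : Nonempty G.E := by
    by_contra hE
    rw [not_nonempty_iff] at hE
    have : Module.finrank ℝ G.H1 ≤ Module.finrank ℝ (G.E → ℝ) := Submodule.finrank_le _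
    rw [Module.finrank_fintype_fun_eq_card, Fintype.card_eq_zero] at this
    rw [genus] at hd
    omega
  have hcells : ∀ x : Fin d → Γ, ∃ e : Fin d → G.E, ∃ t ∈ G.box e,
      ∀ i, G.param (e i) (t i) = x i := by
    intro x
    choose e t ht hx using fun i => G.exists_param_eq ε₀ (x i)
    exact ⟨e, t, fun i _ => ht i, hx⟩
  set A : Set (Fin d → G.E) :=
    {e | ∃ t ∈ G.box e, QuotientAddGroup.mk (G.cellMap q e t) ∈ O} with hA
  have hAne : A.Nonempty := by
    obtain ⟨e, t, ht, hx⟩ := hcells x₀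
    refine ⟨e, t, ht, ?_⟩
    rw [G.mk_cellMap q e ht]
    simpa only [hx] using hx₀
  obtain ⟨e, ⟨t₀, ht₀, h₀⟩, hmax⟩ :=
    A.toFinite.exists_maximalFor (fun e => Module.finrank ℝ (G.cellSpan e)) A hAne
  obtain ⟨t, ht, htO, hgen⟩ := G.exists_generic ht₀ hO h₀
  refine ⟨e, ?_, t, ht, htO⟩
  by_contra hdep
  have hlt : Module.finrank ℝ (G.cellSpan e) < d := by
    by_contra! hge
    exact hdep (G.linearIndependent_of_finrank hge)
  obtain ⟨e₀, he₀⟩ : ∃ e₀, G.edgeClass e₀ ∉ G.cellSpan e := by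
    by_contra! hall
    have h1 : (⊤ : Submodule ℝ G.H1) ≤ G.cellSpan e := by
      rw [← G.span_edgeClass]
      exact Submodule.span_le.2 (range_subset_iff.2 hall)
    rw [top_le_iff.1 h1, finrank_top] at hlt
    exact (hlt.trans_le hd).ne rfl
  have hfib : ∀ x : Fin d → Γ,
      ∑ i, G.pointToJac q (x i) = QuotientAddGroup.mk (G.cellMap q e t) →
      ∀ i ε, x i ∈ G.param ε '' Icc 0 (G.len ε) → G.edgeClass ε ∈ G.cellSpan e := by
    rintro x hx i ε ⟨τ, hτ, hxi⟩
    obtain ⟨e', t', ht', hx'⟩ := hcells x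
    have hbox : Function.update t' i τ ∈ G.box (Function.update e' i ε) := by
      intro j _
      rcases eq_or_ne j i with rfl | hj
      · simpa using hτ
      · simpa [hj] using ht' j (mem_univ j)
    have h1 : ∑ j, G.pointToJac q (G.param (Function.update e' i ε j) (Function.update t' i τ j)) =
        ∑ j, G.pointToJac q (x j) := by
      refine Finset.sum_congr rfl fun j _ => ?_
      rcases eq_or_ne j i with rfl | hj
      · simp [hxi]
      · simp [hj, hx']
    rw [← G.mk_cellMap q _ hbox, hx] at h1
    have h2 := hgen _ _ h1
    have h3 : Function.update e' i ε ∈ A := ⟨_, hbox, h1 ▸ htO⟩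
    have h4 := Submodule.eq_of_le_of_finrank_le h2 (hmax h3 (Submodule.finrank_mono h2))
    rw [h4]
    have h5 := G.edgeClass_mem_cellSpan (Function.update e' i ε) i
    rwa [Function.update_self] at h5
  obtain ⟨u, α, β, hu⟩ := G.exists_isConcavePotential (G.src_mem e₀)
  have hcont : Continuous fun x : Fin d → Γ => ∑ i, G.pointToJac q (x i) :=
    continuous_finsetSum _ fun i _ => (G.continuous_pointToJac q).comp (continuous_apply i)
  have hcompact : IsCompact {x : Fin d → Γ |
      ∑ i, G.pointToJac q (x i) = QuotientAddGroup.mk (G.cellMap q e t)} :=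
    (isClosed_eq hcont continuous_const).isCompact
  obtain ⟨x, hx, hmin⟩ := hcompact.exists_isMinOn
    ⟨fun i => G.param (e i) (t i), (G.mk_cellMap q e (G.openBox_subset_box e ht)).symm⟩
    (f := fun x : Fin d → Γ => ∑ i, u (x i))
    (continuous_finsetSum _ fun i _ => hu.continuous.comp (continuous_apply i)).continuousOn
  have hxmin : G.IsMinimizer q u x := fun x' hx' => hmin (hx'.trans hx)
  obtain ⟨S, hS, hSind, hStouch⟩ := hxmin.exists_independent (G.src_mem e₀) hu fun i hi =>
    he₀ (hfib x hx i e₀ (hi ▸ mem_image_of_mem _ (G.zero_mem_Icc e₀)))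
  have h1 : Submodule.span ℝ (range fun ε : S => G.edgeClass ε) ≤ G.cellSpan e := by
    refine Submodule.span_le.2 (range_subset_iff.2 fun ε => ?_)
    obtain ⟨i, hi⟩ := hStouch ε ε.2
    exact hfib x hx i ε hi
  have h2 := Submodule.finrank_mono h1
  rw [finrank_span_eq_card hSind, Fintype.card_coe] at h2
  omega

end MetricGraph

/-! ### Effective divisors as tuples of points -/

theorem EffDivisor.ofTuple_val {Γ : Type*} {d : ℕ} (x : Fin d → Γ) :
    (EffDivisor.ofTuple Γ d x).1 = ∑ i, Finsupp.single (x i) (1 : ℤ) := rfl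

theorem EffDivisor.ofTuple_surjective (Γ : Type*) (d : ℕ) :
    Function.Surjective (EffDivisor.ofTuple Γ d) := by
  classical
  rintro ⟨D, hD, hdeg⟩
  suffices h : ∃ x : Fin d → Γ, D = ∑ i, Finsupp.single (x i) (1 : ℤ) by
    obtain ⟨x, hx⟩ := h
    exact ⟨x, Subtype.ext hx.symm⟩
  induction d generalizing D with
  | zero =>
    refine ⟨Fin.elim0, ?_⟩
    rw [Finsupp.degree_apply, Nat.cast_zero,
      Finset.sum_eq_zero_iff_of_nonneg fun p _ => hD p] at hdeg
    ext p
    by_cases hp : p ∈ D.support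
    · simpa using hdeg p hp
    · simpa using hp
  | succ d ih =>
    obtain ⟨p, hp⟩ : ∃ p, D p ≠ 0 := by
      by_contra! hall
      have : D = 0 := Finsupp.ext hall
      rw [this, map_zero] at hdeg
      omega
    obtain ⟨x, hx⟩ := ih (D - Finsupp.single p 1) (fun p' => by
        have h1 := hD p'
        simp only [Finsupp.coe_zero, Pi.zero_apply, Finsupp.sub_apply, Finsupp.single_apply] at h1 ⊢
        split_ifs with h
        · subst h
          omega
        · omega) (by
        rw [map_sub, hdeg, Finsupp.degree_single]
        push_cast
        ring)
    refine ⟨Fin.cons p x, ?_⟩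
    rw [Fin.sum_univ_succ, Fin.cons_zero]
    simp only [Fin.cons_succ]
    rw [← hx, add_sub_cancel]

theorem EffDivisor.exists_perm {Γ : Type*} {d : ℕ} {x y : Fin d → Γ}
    (h : EffDivisor.ofTuple Γ d x = EffDivisor.ofTuple Γ d y) :
    ∃ σ : Equiv.Perm (Fin d), ∀ i, y (σ i) = x i := by
  classical
  have hcard : ∀ (z : Fin d → Γ) p, (Fintype.card {i // z i = p} : ℤ) =
      (EffDivisor.ofTuple Γ d z).1 p := by
    intro z p
    rw [EffDivisor.ofTuple_val, Finsupp.finsetSum_apply]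
    simp [Finsupp.single_apply, Fintype.card_subtype]
  have he : ∀ p, Nonempty ({i // x i = p} ≃ {i // y i = p}) := fun p =>
    ⟨Fintype.equivOfCardEq (by exact_mod_cast (hcard x p).trans ((h ▸ hcard y p).symm))⟩
  refine ⟨(Equiv.sigmaFiberEquiv x).symm.trans
    ((Equiv.sigmaCongrRight fun p => (he p).some).trans (Equiv.sigmaFiberEquiv y)), fun i => ?_⟩
  exact ((he (x i)).some ⟨i, rfl⟩).2

theorem EffDivisor.continuous_ofTuple (Γ : Type*) [TopologicalSpace Γ] (d : ℕ) :
    Continuous (EffDivisor.ofTuple Γ d) := continuous_coinduced_rng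

instance (Γ : Type*) [TopologicalSpace Γ] [CompactSpace Γ] (d : ℕ) :
    CompactSpace (EffDivisor Γ d) := by
  refine ⟨?_⟩
  rw [← (EffDivisor.ofTuple_surjective Γ d).range_eq]
  exact isCompact_range (EffDivisor.continuous_ofTuple Γ d)

namespace MetricGraph

variable {Γ : Type*} [MetricSpace Γ] (G : MetricGraph Γ)

/-- The tuples of points in the interiors of edges with independent classes. -/
def independentTuples (d : ℕ) : Set (Fin d → Γ) :=
  {x | ∃ e : Fin d → G.E, (LinearIndependent ℝ fun i => G.edgeClass (e i)) ∧
    ∀ i, x i ∈ G.param (e i) '' Ioo 0 (G.len (e i))}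

/-- The effective divisors which are sums of points in the interiors of edges with independent
classes. -/
def independentDivisors (d : ℕ) : Set (EffDivisor Γ d) :=
  EffDivisor.ofTuple Γ d '' G.independentTuples d

theorem preimage_independentDivisors (d : ℕ) :
    EffDivisor.ofTuple Γ d ⁻¹' G.independentDivisors d = G.independentTuples d := by
  refine Subset.antisymm ?_ (subset_preimage_image _ _)
  rintro x ⟨y, ⟨e, he, hy⟩, h⟩
  obtain ⟨σ, hσ⟩ := EffDivisor.exists_perm h.symm
  exact ⟨e ∘ σ, he.comp σ σ.injective, fun i => hσ i ▸ hy (σ i)⟩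

theorem isOpen_independentDivisors (d : ℕ) : IsOpen (G.independentDivisors d) := by
  change IsOpen (EffDivisor.ofTuple Γ d ⁻¹' G.independentDivisors d)
  rw [preimage_independentDivisors]
  have h : G.independentTuples d =
      ⋃ e ∈ {e : Fin d → G.E | LinearIndependent ℝ fun i => G.edgeClass (e i)},
        Set.pi univ fun i => G.param (e i) '' Ioo 0 (G.len (e i)) := by
    ext x
    simp [independentTuples]
  rw [h]
  exact isOpen_biUnion fun e _ => isOpen_set_pi finite_univ fun i _ => G.isOpen_openEdge (e i)

/-! ### Images of cells are polytopes -/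

/-- The vertices of the box of a tuple of edges. -/
def corner {d : ℕ} (e : Fin d → G.E) (S : Finset (Fin d)) : Fin d → ℝ :=
  fun i => if i ∈ S then G.len (e i) else 0

theorem convexHull_range_corner {d : ℕ} (e : Fin d → G.E) :
    convexHull ℝ (range (G.corner e)) = G.box e := by
  have h : range (G.corner e) = Set.pi univ fun i => {0, G.len (e i)} := by
    classical
    ext t
    constructor
    · rintro ⟨S, rfl⟩ i -
      by_cases hi : i ∈ S <;> simp [corner, hi]
    · intro ht
      refine ⟨Finset.univ.filter fun i => t i ≠ 0, funext fun i => ?_⟩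
      rcases ht i (mem_univ i) with h | h
      · simp [corner, h]
      · rw [mem_singleton_iff] at h
        simp [corner, h, (G.len_pos (e i)).ne']
  rw [h, convexHull_pi, box]
  refine Set.pi_congr rfl fun i _ => ?_
  rw [convexHull_pair, segment_eq_Icc (G.len_pos _).le]

theorem vectorSpan_range_corner {d : ℕ} (e : Fin d → G.E) :
    vectorSpan ℝ (range (G.corner e)) = ⊤ := by
  classical
  refine eq_top_iff.2 fun t _ => ?_
  have h : t = ∑ i, (t i / G.len (e i)) • (G.corner e {i} - G.corner e ∅) := by
    ext j
    rw [Finset.sum_apply, Finset.sum_eq_single j]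
    · simp [corner, (G.len_pos (e j)).ne']
    · intro i _ hij
      simp [corner, hij.symm]
    · simp
  rw [h]
  exact Submodule.sum_mem _ fun i _ => Submodule.smul_mem _ _
    (vsub_mem_vectorSpan ℝ ⟨{i}, rfl⟩ ⟨∅, rfl⟩)

variable [ConnectedSpace Γ]

theorem convexHull_image_corner (q : Γ) {d : ℕ} (e : Fin d → G.E) :
    convexHull ℝ (range fun S => G.cellMap q e (G.corner e S)) = G.cellMap q e '' G.box e := by
  rw [← G.convexHull_range_corner, AffineMap.image_convexHull, ← range_comp]
  rfl

theorem finrank_vectorSpan_corner (q : Γ) {d : ℕ} {e : Fin d → G.E}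
    (he : LinearIndependent ℝ fun i => G.edgeClass (e i)) :
    Module.finrank ℝ (vectorSpan ℝ (range fun S => G.cellMap q e (G.corner e S))) = d := by
  have h : (range fun S => G.cellMap q e (G.corner e S)) =
      G.cellMap q e '' range (G.corner e) := by
    rw [← range_comp]
    rfl
  have hlin : (G.cellMap q e).linear = G.cellLin e := by
    simp [cellMap]
  rw [h, ← AffineMap.map_vectorSpan, vectorSpan_range_corner, hlin, Submodule.map_top,
    LinearMap.finrank_range_of_inj (G.cellLin_injective he), Module.finrank_fin_fun]

/-! ### The effective locus -/

theorem continuous_divisorToJac (q : Γ) (d : ℕ) :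
    Continuous fun D : EffDivisor Γ d => G.divisorToJac q D.1 := by
  refine continuous_coinduced_dom.2 ?_
  have h : ((fun D : EffDivisor Γ d => G.divisorToJac q D.1) ∘ EffDivisor.ofTuple Γ d) =
      fun x : Fin d → Γ => ∑ i, G.pointToJac q (x i) :=
    funext fun x => G.divisorToJac_ofTuple q x
  rw [h]
  exact continuous_finsetSum _ fun i _ => (G.continuous_pointToJac q).comp (continuous_apply i)

theorem eq_of_mem_independentDivisors {q : Γ} {d : ℕ} {D D' : EffDivisor Γ d}
    (hD : D ∈ G.independentDivisors d) (h : G.divisorToJac q D.1 = G.divisorToJac q D'.1) :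
    D = D' := by
  obtain ⟨x, ⟨e, he, hx⟩, rfl⟩ := hD
  obtain ⟨x', rfl⟩ := EffDivisor.ofTuple_surjective Γ d D'
  choose t ht hxt using hx
  choose e' t' ht' hxt' using fun i => G.exists_param_eq (e i) (x' i)
  obtain rfl : (fun i => G.param (e i) (t i)) = x := funext hxt
  obtain rfl : (fun i => G.param (e' i) (t' i)) = x' := funext hxt'
  rw [divisorToJac_ofTuple, divisorToJac_ofTuple] at h
  exact G.rigid he ht ht' h

theorem exists_mem_independentDivisors [CompactSpace Γ] {q : Γ} {d : ℕ} (hd : d ≤ G.genus)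
    (D : EffDivisor Γ d) {O : Set G.Jac} (hO : IsOpen O) (hD : G.divisorToJac q D.1 ∈ O) :
    ∃ D' ∈ G.independentDivisors d, G.divisorToJac q D'.1 ∈ O := by
  obtain ⟨x, rfl⟩ := EffDivisor.ofTuple_surjective Γ d D
  rw [divisorToJac_ofTuple] at hD
  obtain ⟨e, he, t, ht, htO⟩ := G.exists_independent_mem hd x hO hD
  refine ⟨_, ⟨fun i => G.param (e i) (t i), ⟨e, he, fun i =>
    mem_image_of_mem _ (ht i (mem_univ i))⟩, rfl⟩, ?_⟩
  rw [divisorToJac_ofTuple, ← G.mk_cellMap q e (G.openBox_subset_box e ht)]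
  exact htO

theorem picToJac_image_effectiveLocus (q : Γ) (d : ℕ) :
    G.picToJac q d '' G.effectiveLocus d =
      range fun D : EffDivisor Γ d => G.divisorToJac q D.1 := by
  rw [effectiveLocus, ← range_comp]
  exact congrArg range (funext fun D => G.picToJac_abelJacobi q d D)

theorem isPurePolyhedral_effectiveLocus [CompactSpace Γ] (q : Γ) {d : ℕ} (hd : d ≤ G.genus) :
    G.IsPurePolyhedral d (G.picToJac q d '' G.effectiveLocus d) := by
  classical
  set I : Finset (Fin d → G.E) :=
    Finset.univ.filter fun e => LinearIndependent ℝ fun i => G.edgeClass (e i) with hI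
  set c : (Fin d → G.E) → Finset G.H1 := fun e =>
    Finset.univ.image fun S => G.cellMap q e (G.corner e S) with hc
  have hcoe : ∀ e, (c e : Set G.H1) = range fun S => G.cellMap q e (G.corner e S) := fun e => by
    simp [hc]
  refine ⟨I.image c, fun s hs => ?_, ?_⟩
  · obtain ⟨e, he, rfl⟩ := Finset.mem_image.1 hs
    refine ⟨⟨_, Finset.mem_image_of_mem _ (Finset.mem_univ ∅)⟩, ?_⟩
    rw [hcoe]
    exact G.finrank_vectorSpan_corner q (Finset.mem_filter.1 he).2
  · have h1 : (⋃ s ∈ I.image c, (QuotientAddGroup.mk : G.H1 → G.Jac) '' convexHull ℝ (s : Set G.H1))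
        = ⋃ e ∈ I, (fun t => (QuotientAddGroup.mk (G.cellMap q e t) : G.Jac)) '' G.box e := by
      rw [Finset.set_biUnion_finset_image]
      refine iUnion₂_congr fun e _ => ?_
      rw [hcoe, convexHull_image_corner, image_image]
    rw [h1, picToJac_image_effectiveLocus]
    refine Subset.antisymm ?_ (iUnion₂_subset fun e _ => ?_)
    · have hclosed : IsClosed (⋃ e ∈ I,
          (fun t => (QuotientAddGroup.mk (G.cellMap q e t) : G.Jac)) '' G.box e) := by
        refine I.finite_toSet.isClosed_biUnion fun e _ => IsCompact.isClosed ?_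
        exact (isCompact_univ_pi fun i => isCompact_Icc).image
          (QuotientAddGroup.continuous_mk.comp (G.continuous_cellMap q e))
      rintro _ ⟨D, rfl⟩
      obtain ⟨x, rfl⟩ := EffDivisor.ofTuple_surjective Γ d D
      by_contra hn
      obtain ⟨e, he, t, ht, h⟩ := G.exists_independent_mem (q := q) hd x hclosed.isOpen_compl (by
        rw [← divisorToJac_ofTuple]
        exact hn)
      exact h (mem_biUnion (Finset.mem_coe.2 (Finset.mem_filter.2 ⟨Finset.mem_univ e, he⟩))
        (mem_image_of_mem _ (G.openBox_subset_box e ht)))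
    · rintro _ ⟨t, ht, rfl⟩
      refine ⟨EffDivisor.ofTuple Γ d fun i => G.param (e i) (t i), ?_⟩
      beta_reduce
      rw [divisorToJac_ofTuple, G.mk_cellMap q e ht]

end MetricGraph

theorem theorem7p2 {Γ : Type*} [MetricSpace Γ] [CompactSpace Γ] [ConnectedSpace Γ]
    (G : MetricGraph Γ) (q : Γ) (d : ℕ) (hd : d ≤ G.genus) :
    letI := G.picTopology q d
    (∃ U : Set (G.Pic d), U ⊆ G.effectiveLocus d ∧
      (∃ O : Set (G.Pic d), IsOpen O ∧ U = O ∩ G.effectiveLocus d) ∧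
      G.effectiveLocus d ⊆ closure U ∧
      IsHomeomorph (U.restrictPreimage (G.abelJacobi d))) ∧
    G.IsPurePolyhedral d (G.picToJac q d '' G.effectiveLocus d) := by
  let _ := G.picTopology q d
  refine ⟨?_, G.isPurePolyhedral_effectiveLocus q hd⟩
  have hJ := G.picToJac_abelJacobi q d
  have hJcont : Continuous (G.picToJac q d) := continuous_induced_dom
  have hclosed : ∀ C : Set (EffDivisor Γ d), IsClosed C →
      IsClosed ((fun D : EffDivisor Γ d => G.divisorToJac q D.1) '' C) := fun C hC =>
    (hC.isCompact.image (G.continuous_divisorToJac q d)).isClosed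
  have hcont : Continuous (G.abelJacobi d) := by
    refine continuous_induced_rng.2 ?_
    convert G.continuous_divisorToJac q d using 1
    exact funext hJ
  set W := G.independentDivisors d with hW
  have hWopen : IsOpen W := G.isOpen_independentDivisors d
  have hU : G.abelJacobi d '' W = G.picToJac q d ⁻¹'
      ((fun D : EffDivisor Γ d => G.divisorToJac q D.1) '' Wᶜ)ᶜ ∩ G.effectiveLocus d := by
    ext y
    constructor
    · rintro ⟨D, hD, rfl⟩
      refine ⟨?_, D, rfl⟩
      rintro ⟨D', hD', h⟩
      rw [hJ] at h
      exact hD' (G.eq_of_mem_independentDivisors hD h.symm ▸ hD)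
    · rintro ⟨hy, D, rfl⟩
      by_contra hn
      exact hy ⟨D, fun hD => hn ⟨D, hD, rfl⟩, (hJ D).symm⟩
  refine ⟨G.abelJacobi d '' W, ?_, ⟨_, (hclosed _ hWopen.isClosed_compl).isOpen_compl.preimage
    hJcont, hU⟩, ?_, ?_⟩
  · rintro _ ⟨D, -, rfl⟩
    exact ⟨D, rfl⟩
  · rintro _ ⟨D, rfl⟩
    refine closure_induced.2 (mem_closure_iff.2 fun O hO hDO => ?_)
    rw [hJ] at hDO
    obtain ⟨D', hD', h⟩ := G.exists_mem_independentDivisors hd D hO hDO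
    exact ⟨_, h, _, mem_image_of_mem _ hD', hJ D'⟩
  · rw [isHomeomorph_iff_continuous_isClosedMap_bijective]
    have hmem : ∀ {D D' : EffDivisor Γ d}, G.abelJacobi d D ∈ G.abelJacobi d '' W →
        G.divisorToJac q D.1 = G.divisorToJac q D'.1 → D = D' := by
      rintro D D' ⟨D₀, hD₀, h₀⟩ h
      have h1 : G.divisorToJac q D₀.1 = G.divisorToJac q D.1 := by rw [← hJ, ← hJ, h₀]
      rw [← G.eq_of_mem_independentDivisors hD₀ h1]
      exact G.eq_of_mem_independentDivisors hD₀ (h1.trans h)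
    refine ⟨hcont.restrictPreimage, fun C hC => ?_, fun D D' h => ?_, fun y => ?_⟩
    · obtain ⟨K, hK, rfl⟩ := isClosed_induced_iff.1 hC
      have h : (G.abelJacobi d '' W).restrictPreimage (G.abelJacobi d) '' (Subtype.val ⁻¹' K) =
          (fun y : G.abelJacobi d '' W => G.picToJac q d y) ⁻¹'
            ((fun D : EffDivisor Γ d => G.divisorToJac q D.1) '' K) := by
        ext y
        constructor
        · rintro ⟨D, hD, rfl⟩
          exact ⟨D, hD, (hJ D).symm⟩
        · rintro ⟨D', hD', h⟩
          obtain ⟨y, D, hD, rfl⟩ := y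
          beta_reduce at h
          rw [hJ] at h
          obtain rfl := hmem (mem_image_of_mem _ hD) h.symm
          exact ⟨⟨D, mem_image_of_mem _ hD⟩, hD', rfl⟩
      rw [h]
      exact (hclosed K hK).preimage (hJcont.comp continuous_subtype_val)
    · refine Subtype.ext (hmem D.2 ?_)
      have h1 : G.abelJacobi d D.1 = G.abelJacobi d D'.1 := congrArg Subtype.val h
      rw [← hJ, ← hJ, h1]
    · obtain ⟨y, D, hD, rfl⟩ := y
      exact ⟨⟨D, mem_image_of_mem _ hD⟩, rfl⟩
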